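/- **Setting.** The Ablowitz–Ladik system for $\alpha:\mathbb R\times\mathbb Z\to\mathbb C$ is $$\mathrm i\,\partial_t\alpha_n=-(\alpha_{n-1}-2\alpha_n+\alpha_{n+1})+\alpha_n\beta_n(\alpha_{n-1}+\alpha_{n+1}),$$ where $\beta_n=\overline{\alpha_n}$ in the defocusing case and $\beta_n=-\overline{\alpha_n}$ in the focusing case; below, upper signs refer to the defocusing case and lower signs to the focusing case. Fix $0<\gamma\le\frac{13}{18}$. Let $\psi_0,\phi_0\in L^2(\mathbb R)$, let $0<h\le1$ with $100\,h\,\bigl(\|\psi_0\|_{L^2}^2+\|\phi_0\|_{L^2}^2\bigr)\le1$, and put $N=h^{-\gamma}$. Let $P_{\le N}f(x)=\int_{|\xi|\le N}\widehat f(\xi)e^{\mathrm ix\xi}\frac{d\xi}{2\pi}$ with $\widehat f(\xi)=\int_{\mathbb R} f(x)e^{-\mathrm ix\xi}\,dx$, and let $\alpha\in C(\mathbb R;\ell^2(\mathbb Z))$ be the global solution of the system with initial data $$\alpha_n(0)=h\,[P_{\le N}\psi_0](hn)+(-1)^n h\,[P_{\le N}\phi_0](hn).$$ For $a\in\ell^2(\mathbb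 Z)$, with $b=\pm\bar a$, let $M(a)=-\sum_n\ln(1-a_nb_n)$ and, for $|z|>1$, $$\mathbf A(z;a)=\sum_{\ell\ge1}\tfrac{(-1)^{\ell+1}}{\ell}\,\mathrm{tr}\bigl\{(\Lambda\Gamma)^\ell\bigr\},\qquad \Lambda=a\,(S-z^{-1})^{-1},\quad \Gamma=b\,(z-S)^{-1},$$ where $(Sf)_n=f_{n+1}$ on $\ell^2(\mathbb Z)$ and $a,b$ act by multiplication. For $\kappa>0$ set $$\mathbf G(\kappa h;a)=\pm\tfrac{2}{e^{4\kappa h}+1}M(a)\mp\tanh(2\kappa h)\,\mathrm{Re}\bigl[\mathbf A(e^{\kappa h};a)+\mathbf A(\mathrm i e^{\kappa h};a)\bigr],$$ whose quadratic part is, with $\widehat a(\theta)=\sum_n a_ne^{-\mathrm in\theta}$, $$\mathbf G^{[2]}(\kappa h;a)=\int_{-\pi}^{\pi}\frac{\sin^2(\theta)\,|\widehat a(\theta)|^2}{\sinh^2(2\kappa h)+\sin^2(\theta)}\,\frac{d\theta}{2\pi}.$$ **Proposition 3.3.** There are an absolute constant $C>0$ and a number $\kappa_0>0$, depending only on $\|\psi_0\|_{L^2}$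 and $\|\phi_0\|_{L^2}$, such that for all $\kappa\ge\kappa_0$ and all $t\in\mathbb R$ (and all $h$, $\gamma$ as above) the series defining $\mathbf G(\kappa h;\alpha(t))$ converge (each $(\Lambda\Gamma)^\ell$ being trace class), the value $\mathbf G(\kappa h;\alpha(t))$ is independent of $t$, and $$\bigl|\mathbf G(\kappa h;\alpha(t))-\mathbf G^{[2]}(\kappa h;\alpha(t))\bigr|\le \frac{C}{\sinh(\kappa h)}\,\|\alpha(0)\|_{\ell^2}^4 .$$ -/

import Mathlib

open MeasureTheory
open scoped ENNReal FourierTransform ComplexConjugate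

noncomputable section

namespace AblowitzLadik

/-- The Hilbert space `ℓ²(ℤ)` of complex sequences. -/
abbrev EllTwo : Type := lp (fun _ : ℤ => ℂ) 2

/-- The Hilbert space `L²(ℝ)` of complex functions. -/
abbrev LTwo : Type := Lp ℂ 2 (volume : Measure ℝ)

/-! ### The equation

The sign `s` is `1` in the defocusing case and `-1` in the focusing case. -/

/-- The sequence `β = s ᾱ`. -/
def beta (s : ℝ) (a : EllTwo) : EllTwo := (s : ℂ) • star a

/-- The right-hand side of the Ablowitz--Ladik system at the site `n`:
`-(α_{n-1} - 2 α_n + α_{n+1}) + α_n β_n (α_{n-1} + α_{n+1})`. -/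
def rhs (s : ℝ) (a : EllTwo) (n : ℤ) : ℂ :=
  -(a (n - 1) - 2 * a n + a (n + 1)) + a n * beta s a n * (a (n - 1) + a (n + 1))

/-- `α` is a global solution, in `C(ℝ; ℓ²(ℤ))`, of the Ablowitz--Ladik system
`i ∂ₜ α_n = -(α_{n-1} - 2 α_n + α_{n+1}) + α_n β_n (α_{n-1} + α_{n+1})`. -/
structure IsSolution (s : ℝ) (α : ℝ → EllTwo) : Prop where
  continuous : Continuous α
  equation : ∀ (t : ℝ) (n : ℤ), ∃ v : ℂ,
    HasDerivAt (fun τ : ℝ => α τ n) v t ∧ Complex.I * v = rhs s (α t) n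

/-! ### The initial data -/

/-- The value at `x` of (the continuous representative of) `P_{≤ N} f`, the sharp projection of
`f ∈ L²(ℝ)` to the frequencies `|ξ| ≤ N`, where `f̂(ξ) = ∫ f(x) e^{-i x ξ} dx`. In terms of
Mathlib's transform, `f̂(ξ) = (𝓕 f)(ξ / 2π)`, so that
`∫_{|ξ| ≤ N} f̂(ξ) e^{i x ξ} dξ / 2π = ∫_{|2 π η| ≤ N} (𝓕 f)(η) e^{2 π i x η} dη`. -/
def freqProj (N : ℝ) (f : LTwo) (x : ℝ) : ℂ :=
  ∫ η in {η : ℝ | |2 * Real.pi * η| ≤ N},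
    (𝓕 f : LTwo) η * Complex.exp (Complex.I * ((2 * Real.pi * x * η : ℝ) : ℂ))

/-- The lattice data `h [P_{≤ N} ψ₀](h n) + (-1)^n h [P_{≤ N} φ₀](h n)`, with `N = h^{-γ}`. -/
def initialData (γ h : ℝ) (ψ₀ φ₀ : LTwo) (n : ℤ) : ℂ :=
  h * freqProj (h ^ (-γ)) ψ₀ (h * n) + (-1) ^ n * (h * freqProj (h ^ (-γ)) φ₀ (h * n))

/-! ### Operators on `ℓ²(ℤ)` -/

theorem memlp_shift (f : EllTwo) : Memℓp (fun n : ℤ => f (n + 1)) 2 := by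
  have hf := lp.memℓp f
  rw [memℓp_gen_iff (by norm_num)] at hf ⊢
  exact (Equiv.addRight (1 : ℤ)).summable_iff.mpr hf

/-- The shift `(S f)_n = f_{n+1}` on `ℓ²(ℤ)`. -/
def shift : EllTwo →L[ℂ] EllTwo :=
  LinearMap.mkContinuous
    { toFun := fun f => ⟨fun n => f (n + 1), memlp_shift f⟩
      map_add' := fun _ _ => rfl
      map_smul' := fun _ _ => rfl }
    1
    (fun f => by
      refine lp.norm_le_of_tsum_le (by norm_num) (by positivity) ?_
      rw [one_mul, lp.norm_rpow_eq_tsum (by norm_num)]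
      exact le_of_eq ((Equiv.addRight (1 : ℤ)).tsum_eq fun n => ‖f n‖ ^ (2 : ℝ≥0∞).toReal))

/-- The operator of multiplication by the sequence `a` on `ℓ²(ℤ)`. -/
def mulOp (a : EllTwo) : EllTwo →L[ℂ] EllTwo :=
  lp.mapCLM 2 (fun n => a n • ContinuousLinearMap.id ℂ ℂ) (norm_nonneg a) (fun n => by
    rw [norm_smul, ContinuousLinearMap.norm_id, mul_one]
    exact lp.norm_apply_le_norm (by norm_num) a n)

@[simp] theorem shift_apply (f : EllTwo) (n : ℤ) : shift f n = f (n + 1) := rfl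

@[simp] theorem mulOp_apply (a f : EllTwo) (n : ℤ) : mulOp a f n = a n * f n := rfl

/-- `Λ(z; α) = α (S - z⁻¹)⁻¹`. -/
def Lam (z : ℂ) (a : EllTwo) : EllTwo →L[ℂ] EllTwo :=
  mulOp a * Ring.inverse (shift - z⁻¹ • (1 : EllTwo →L[ℂ] EllTwo))

/-- `Γ(z; α) = β (z - S)⁻¹`. -/
def Gam (s : ℝ) (z : ℂ) (a : EllTwo) : EllTwo →L[ℂ] EllTwo :=
  mulOp (beta s a) * Ring.inverse (z • (1 : EllTwo →L[ℂ] EllTwo) - shift)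

/-- The matrix entry `Ω_{nm}` of an operator on `ℓ²(ℤ)`. -/
def entry (Ω : EllTwo →L[ℂ] EllTwo) (n m : ℤ) : ℂ := Ω (lp.single 2 m 1) n

/-- Hilbert--Schmidt operators: the matrix entries are square summable. -/
def IsHilbertSchmidt (Ω : EllTwo →L[ℂ] EllTwo) : Prop :=
  Summable fun p : ℤ × ℤ => ‖entry Ω p.1 p.2‖ ^ 2

/-- Trace class operators: products of two Hilbert--Schmidt operators. -/
def IsTraceClass (Ω : EllTwo →L[ℂ] EllTwo) : Prop :=
  ∃ Ω₁ Ω₂, IsHilbertSchmidt Ω₁ ∧ IsHilbertSchmidt Ω₂ ∧ Ω = Ω₁ * Ω₂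

/-- The trace (meaningful for trace class operators). -/
def trace (Ω : EllTwo →L[ℂ] EllTwo) : ℂ := ∑' n : ℤ, entry Ω n n

/-! ### The conserved functionals -/

/-- `M(α) = - ∑ ln (1 - α_n β_n)`; the number `α_n β_n = s |α_n|²` is real. -/
def mass (s : ℝ) (a : EllTwo) : ℝ := -∑' n : ℤ, Real.log (1 - (a n * beta s a n).re)

/-- The series defining `M(α)` has well-defined terms and converges. -/
def MassConverges (s : ℝ) (a : EllTwo) : Prop :=
  (∀ n : ℤ, 0 < 1 - (a n * beta s a n).re) ∧
    Summable fun n : ℤ => Real.log (1 - (a n * beta s a n).re)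

/-- The term `((-1)^{ℓ+1} / ℓ) tr {(Λ Γ)^ℓ}` with `ℓ = k + 1`, for `k = 0, 1, 2, …`. -/
def traceTerm (s : ℝ) (z : ℂ) (a : EllTwo) (k : ℕ) : ℂ :=
  (-1) ^ (k + 2) / ((k : ℂ) + 1) * trace ((Lam z a * Gam s z a) ^ (k + 1))

/-- `A(z; α) = ∑_{ℓ ≥ 1} ((-1)^{ℓ+1} / ℓ) tr {(Λ Γ)^ℓ}`. -/
def genA (s : ℝ) (z : ℂ) (a : EllTwo) : ℂ := ∑' k : ℕ, traceTerm s z a k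

/-- The series defining `A(z; α)` has well-defined terms (the inverses exist and the operators are
trace class) and converges (absolutely). -/
def GenAConverges (s : ℝ) (z : ℂ) (a : EllTwo) : Prop :=
  IsUnit (shift - z⁻¹ • (1 : EllTwo →L[ℂ] EllTwo)) ∧
    IsUnit (z • (1 : EllTwo →L[ℂ] EllTwo) - shift) ∧
    (∀ k : ℕ, IsTraceClass ((Lam z a * Gam s z a) ^ (k + 1))) ∧
    Summable (traceTerm s z a)

/-- `G(y; α) = ± 2 / (e^{4y} + 1) M(α) ∓ tanh(2y) Re [A(e^y; α) + A(i e^y; α)]`, with the upper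
signs in the defocusing case. -/
def funG (s y : ℝ) (a : EllTwo) : ℝ :=
  s * (2 / (Real.exp (4 * y) + 1)) * mass s a -
    s * Real.tanh (2 * y) *
      (genA s (Real.exp y : ℂ) a + genA s (Complex.I * (Real.exp y : ℂ)) a).re

/-- All of the series defining `G(y; α)` converge. -/
def FunGConverges (s y : ℝ) (a : EllTwo) : Prop :=
  MassConverges s a ∧ GenAConverges s (Real.exp y : ℂ) a ∧
    GenAConverges s (Complex.I * (Real.exp y : ℂ)) a

instance twoPiPos : Fact (0 < 2 * Real.pi) := ⟨Real.two_pi_pos⟩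

/-- The Fourier transform `α̂(θ) = ∑ α_n e^{-i n θ}` of `α ∈ ℓ²(ℤ)`, a series that converges in
`L²` of the circle `ℝ / 2πℤ`; note that `fourier (-n) θ = e^{-i n θ}`. -/
def latticeFourier (a : EllTwo) : Lp ℂ 2 (AddCircle.haarAddCircle (T := 2 * Real.pi)) :=
  ∑' n : ℤ, a n • fourierLp (T := 2 * Real.pi) 2 (-n)

/-- The quadratic part
`G^{[2]}(y; α) = ∫_{-π}^{π} sin² θ |α̂(θ)|² / (sinh² (2y) + sin² θ) dθ / 2π` of `G(y; α)`. -/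
def funGQuad (y : ℝ) (a : EllTwo) : ℝ :=
  ∫ θ in (-Real.pi)..Real.pi,
    Real.sin θ ^ 2 * ‖latticeFourier a ((θ : ℝ) : AddCircle (2 * Real.pi))‖ ^ 2 /
      (Real.sinh (2 * y) ^ 2 + Real.sin θ ^ 2) / (2 * Real.pi)

end AblowitzLadik

end

open AblowitzLadik

noncomputable section

namespace AblowitzLadik

/-! Formally `A(z; a)` is log det(1 + ΛΓ), the perturbation determinant of the block operator [[z -
S, a], [b, z⁻¹ - S]], whose transfer matrices belong to the Lax pair of the flow. The theorem rests
on a size estimate and a conservation law.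

Size. ΛΓ is a product of two Hilbert–Schmidt operators, whose norms are ‖a‖ times the ℓ² norms of
the resolvent kernels. Hence |tr (ΛΓ)^ℓ| ≤ (‖a‖² / (2 sinh y))^ℓ when |z| = e^y
(`norm_trace_opU_pow_le`, `resConst_eq`). Sampling a band-limited function gives ‖α(0)‖² = O(h)
(`norm_sq_initialData_le`), and conservation of M propagates this in time (`IsSolution.norm_sq_le`).
Since sinh(κh) ≥ κh, a large κ makes the ratio at most 1/2, uniformly in h. The terms ℓ ≥ 2 of A,
and the error M - s‖a‖², are then quartic. The leading terms assemble into the quadratic part by a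
Poisson kernel identity (`poisson_identity`, `funGQuad_eq_quadratic`).

Conservation. The equation is known only site by site, so the coefficients are truncated to [-K, K]
before differentiating. The derivative of the truncated series is a sum of velocities times diagonal
entries of the Green's function (`partialTrace_inverse_mul`). The zero-curvature equation turns this
sum into a difference of fluxes (`flux_succ_sub`), controlled by the values of α near ±K
(`norm_boundary_le`). A continuous curve in ℓ² has uniformly small far coordinates on compact time
intervals, so the limit K → ∞ is constant (`eq_of_hasDerivAt_boundary`). The mass is treated in the
same way, with an explicit current. -/

theorem hasSum_of_eq {ι E : Type*} [AddCommMonoid E] [TopologicalSpace E] {f g : ι → E} {x : E}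
    (hf : HasSum f x) (h : ∀ i, g i = f i) : HasSum g x := by
  rwa [funext h]

theorem hasSum_comp_subLeft {E : Type*} [AddCommMonoid E] [TopologicalSpace E] {f : ℤ → E} {x : E}
    (hf : HasSum f x) (n : ℤ) : HasSum (fun m => f (n - m)) x :=
  (Equiv.subLeft n).hasSum_iff (f := f).mpr hf

theorem hasSum_comp_subRight {E : Type*} [AddCommMonoid E] [TopologicalSpace E] {f : ℤ → E} {x : E}
    (hf : HasSum f x) (n : ℤ) : HasSum (fun m => f (m - n)) x :=
  (Equiv.subRight n).hasSum_iff (f := f).mpr hf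

/-! ### Square summable sequences -/

theorem hasSum_norm_sq (f : EllTwo) : HasSum (fun n => ‖f n‖ ^ 2) (‖f‖ ^ 2) := by
  have h := lp.hasSum_norm (p := 2) (by norm_num) f
  simpa using h

theorem memlp_of_summable {f : ℤ → ℂ} (h : Summable fun n => ‖f n‖ ^ 2) : Memℓp f 2 := by
  rw [memℓp_gen_iff (by norm_num)]
  simpa using h

theorem norm_apply_le (f : EllTwo) (n : ℤ) : ‖f n‖ ≤ ‖f‖ :=
  lp.norm_apply_le_norm (by norm_num) f n

theorem single_one_apply (m n : ℤ) :
    (lp.single 2 m (1 : ℂ) : EllTwo) n = if n = m then 1 else 0 := by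
  rw [lp.single_apply]
  simp [Pi.single_apply]

/-- Evaluation at a site. -/
def coord (n : ℤ) : EllTwo →L[ℂ] ℂ := lp.evalCLM ℂ (fun _ : ℤ => ℂ) 2 n

@[simp] theorem coord_apply (n : ℤ) (f : EllTwo) : coord n f = f n := rfl

theorem sum_apply {ι : Type*} (F : Finset ι) (f : ι → EllTwo) (n : ℤ) :
    (∑ i ∈ F, f i) n = ∑ i ∈ F, f i n := by
  exact map_sum (coord n) f F

theorem norm_le_of_forall_sq_le {f : EllTwo} {g : ℤ → ℝ} {C : ℝ} (hC : 0 ≤ C)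
    (hg : HasSum g (C ^ 2)) (h : ∀ n, ‖f n‖ ^ 2 ≤ g n) : ‖f‖ ≤ C := by
  have := hasSum_le h (hasSum_norm_sq f) hg
  exact le_of_sq_le_sq this hC

/-! ### Matrix entries -/

theorem single_eq_smul (m : ℤ) (c : ℂ) :
    (lp.single 2 m c : EllTwo) = c • (lp.single 2 m (1 : ℂ) : EllTwo) := by
  rw [← lp.single_smul]
  simp

theorem hasSum_entry (R : EllTwo →L[ℂ] EllTwo) (f : EllTwo) (n : ℤ) :
    HasSum (fun m => entry R n m * f m) (R f n) := by
  have h := (lp.hasSum_single (p := 2) (by norm_num) f).mapL ((coord n).comp R)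
  refine hasSum_of_eq h fun m => ?_
  rw [single_eq_smul, map_smul]
  exact mul_comm _ _

theorem norm_single_one (m : ℤ) : ‖(lp.single 2 m (1 : ℂ) : EllTwo)‖ = 1 := by
  rw [lp.norm_single (by norm_num)]
  simp

theorem norm_entry_le (R : EllTwo →L[ℂ] EllTwo) (n m : ℤ) : ‖entry R n m‖ ≤ ‖R‖ := by
  refine (norm_apply_le _ n).trans ?_
  simpa [norm_single_one] using R.le_opNorm (lp.single 2 m (1 : ℂ))

theorem hasSum_entry_mul (A B : EllTwo →L[ℂ] EllTwo) (n m : ℤ) :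
    HasSum (fun k => entry A n k * entry B k m) (entry (A * B) n m) :=
  hasSum_entry A (B (lp.single 2 m 1)) n

@[simp] theorem entry_mulOp_mul (a : EllTwo) (R : EllTwo →L[ℂ] EllTwo) (n m : ℤ) :
    entry (mulOp a * R) n m = a n * entry R n m := rfl

theorem mulOp_single (a : EllTwo) (m : ℤ) :
    mulOp a (lp.single 2 m 1) = a m • (lp.single 2 m (1 : ℂ) : EllTwo) := by
  ext n
  rw [mulOp_apply, lp.coeFn_smul, Pi.smul_apply, single_one_apply]
  split_ifs with h <;> simp [h]

@[simp] theorem entry_mul_mulOp (a : EllTwo) (R : EllTwo →L[ℂ] EllTwo) (n m : ℤ) :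
    entry (R * mulOp a) n m = entry R n m * a m := by
  simp only [entry, mul_apply_eq_comp, mulOp_single, map_smul]
  simp [mul_comm]

@[simp] theorem entry_shift_mul (R : EllTwo →L[ℂ] EllTwo) (n m : ℤ) :
    entry (shift * R) n m = entry R (n + 1) m := rfl

theorem shift_single (m : ℤ) :
    shift (lp.single 2 m 1) = (lp.single 2 (m - 1) (1 : ℂ) : EllTwo) := by
  ext n
  rw [shift_apply, single_one_apply, single_one_apply]
  congr 1
  exact propext ⟨fun h => by omega, fun h => by omega⟩

@[simp] theorem entry_mul_shift (R : EllTwo →L[ℂ] EllTwo) (n m : ℤ) :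
    entry (R * shift) n m = entry R n (m - 1) := by
  simp only [entry, mul_apply_eq_comp, shift_single]

@[simp] theorem entry_add (A B : EllTwo →L[ℂ] EllTwo) (n m : ℤ) :
    entry (A + B) n m = entry A n m + entry B n m := rfl

@[simp] theorem entry_sub (A B : EllTwo →L[ℂ] EllTwo) (n m : ℤ) :
    entry (A - B) n m = entry A n m - entry B n m := rfl

@[simp] theorem entry_neg (A : EllTwo →L[ℂ] EllTwo) (n m : ℤ) :
    entry (-A) n m = -entry A n m := rfl

@[simp] theorem entry_smul (c : ℂ) (A : EllTwo →L[ℂ] EllTwo) (n m : ℤ) :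
    entry (c • A) n m = c * entry A n m := rfl

theorem entry_one (n m : ℤ) : entry 1 n m = if n = m then 1 else 0 := single_one_apply m n

/-- The matrix entry as a continuous linear functional of the operator. -/
def entryCLM (n m : ℤ) : (EllTwo →L[ℂ] EllTwo) →L[ℂ] ℂ :=
  (coord n).comp (ContinuousLinearMap.apply ℂ EllTwo (lp.single 2 m (1 : ℂ)))

@[simp] theorem entryCLM_apply (n m : ℤ) (A : EllTwo →L[ℂ] EllTwo) :
    entryCLM n m A = entry A n m := rfl

/-! ### Convolution operators composed with multiplication operators -/

section Conv

variable {R : EllTwo →L[ℂ] EllTwo} {g : ℤ → ℂ} {c : ℝ}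

/-- Cauchy–Schwarz in row `n`. The bound is uniform in `n`; multiplication by a sequence in ℓ²
afterwards supplies the decay. -/
theorem norm_conv_apply_le (hR : ∀ n m, entry R n m = g (n - m)) (hc : 0 ≤ c)
    (hg : HasSum (fun d => ‖g d‖ ^ 2) (c ^ 2)) (f : EllTwo) (n : ℤ) : ‖R f n‖ ≤ c * ‖f‖ := by
  have h1 : HasSum (fun m => ‖entry R n m‖ ^ 2) (c ^ 2) := by
    simp only [hR]
    exact hasSum_comp_subLeft hg n
  have h2 := hasSum_norm_sq f
  have h3 := Real.inner_le_Lp_mul_Lq_hasSum_of_nonneg (p := 2) (q := 2)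
    (f := fun m => ‖entry R n m‖) (g := fun m => ‖f m‖)
    (by rw [Real.holderConjugate_iff]; norm_num) hc (norm_nonneg f)
    (fun _ => norm_nonneg _) (fun _ => norm_nonneg _) (by simpa using h1) (by simpa using h2)
  obtain ⟨C, -, hC, hs⟩ := h3
  rw [← (hasSum_entry R f n).tsum_eq]
  refine (norm_tsum_le_tsum_norm (by simpa using hs.summable)).trans ?_
  simpa [hs.tsum_eq] using hC

theorem norm_mulOp_conv_apply_le (hR : ∀ n m, entry R n m = g (n - m)) (hc : 0 ≤ c)
    (hg : HasSum (fun d => ‖g d‖ ^ 2) (c ^ 2)) (a f : EllTwo) (n : ℤ) :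
    ‖(mulOp a * R) f n‖ ≤ ‖a n‖ * (c * ‖f‖) := by
  rw [mul_apply_eq_comp, mulOp_apply, norm_mul]
  exact mul_le_mul_of_nonneg_left (norm_conv_apply_le hR hc hg f n) (norm_nonneg _)

theorem norm_mulOp_conv_le (hR : ∀ n m, entry R n m = g (n - m)) (hc : 0 ≤ c)
    (hg : HasSum (fun d => ‖g d‖ ^ 2) (c ^ 2)) (a : EllTwo) : ‖mulOp a * R‖ ≤ ‖a‖ * c := by
  refine ContinuousLinearMap.opNorm_le_bound _ (by positivity) fun f => ?_
  refine norm_le_of_forall_sq_le (g := fun n => ‖a n‖ ^ 2 * (c * ‖f‖) ^ 2) (by positivity) ?_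
    fun n => ?_
  · rw [show (‖a‖ * c * ‖f‖) ^ 2 = ‖a‖ ^ 2 * (c * ‖f‖) ^ 2 by ring]
    exact (hasSum_norm_sq a).mul_right _
  · rw [← mul_pow]
    gcongr
    exact norm_mulOp_conv_apply_le hR hc hg a f n

theorem hasSum_norm_sq_entry_mulOp_conv (hR : ∀ n m, entry R n m = g (n - m))
    (hg : HasSum (fun d => ‖g d‖ ^ 2) (c ^ 2)) (a : EllTwo) :
    HasSum (fun p : ℤ × ℤ => ‖entry (mulOp a * R) p.1 p.2‖ ^ 2) ((‖a‖ * c) ^ 2) := by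
  have h1 : ∀ n, HasSum (fun m => ‖entry (mulOp a * R) n m‖ ^ 2) (‖a n‖ ^ 2 * c ^ 2) := fun n => by
    simp only [entry_mulOp_mul, hR, norm_mul, mul_pow]
    exact (hasSum_comp_subLeft hg n).mul_left _
  have h2 := (hasSum_norm_sq a).mul_right (c ^ 2)
  have hs : Summable fun p : ℤ × ℤ => ‖entry (mulOp a * R) p.1 p.2‖ ^ 2 := by
    rw [summable_prod_of_nonneg (fun _ => by positivity)]
    refine ⟨fun n => (h1 n).summable, ?_⟩
    simpa only [(h1 _).tsum_eq] using h2.summable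
  have h3 := hs.hasSum.prod_fiberwise h1
  rw [mul_pow, h2.unique h3]
  exact hs.hasSum

theorem isHilbertSchmidt_mulOp_conv (hR : ∀ n m, entry R n m = g (n - m))
    (hg : HasSum (fun d => ‖g d‖ ^ 2) (c ^ 2)) (a : EllTwo) : IsHilbertSchmidt (mulOp a * R) :=
  (hasSum_norm_sq_entry_mulOp_conv hR hg a).summable

theorem hasSum_norm_sq_mulOp_conv_single (hR : ∀ n m, entry R n m = g (n - m))
    (hg : HasSum (fun d => ‖g d‖ ^ 2) (c ^ 2)) (a : EllTwo) :
    HasSum (fun m : ℤ => ‖(mulOp a * R) (lp.single 2 m 1)‖ ^ 2) ((‖a‖ * c) ^ 2) := by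
  have h := (Equiv.prodComm ℤ ℤ).hasSum_iff.mpr (hasSum_norm_sq_entry_mulOp_conv hR hg a)
  have h1 : ∀ m : ℤ, HasSum (fun n : ℤ => ‖entry (mulOp a * R) n m‖ ^ 2)
      (‖(mulOp a * R) (lp.single 2 m 1)‖ ^ 2) := fun m =>
    hasSum_norm_sq ((mulOp a * R) (lp.single 2 m 1))
  have h2 : HasSum (fun p : ℤ × ℤ => ‖entry (mulOp a * R) p.2 p.1‖ ^ 2) ((‖a‖ * c) ^ 2) := h
  exact h2.prod_fiberwise h1

end Conv

/-- The Hilbert–Schmidt condition is rewritten by columns as ∑ ‖C e_m‖² < ∞, and left multiplication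
by `B` enlarges each column by at most ‖B‖. -/
theorem IsHilbertSchmidt.mul_left {A : EllTwo →L[ℂ] EllTwo} (hA : IsHilbertSchmidt A)
    (B : EllTwo →L[ℂ] EllTwo) : IsHilbertSchmidt (B * A) := by
  have key : ∀ C : EllTwo →L[ℂ] EllTwo, IsHilbertSchmidt C ↔
      Summable fun m : ℤ => ‖C (lp.single 2 m 1)‖ ^ 2 := fun C => by
    unfold IsHilbertSchmidt
    rw [← (Equiv.prodComm ℤ ℤ).summable_iff, summable_prod_of_nonneg (fun _ => by
      simp only [Function.comp]; positivity)]
    have h1 : ∀ m : ℤ, HasSum (fun n => ‖entry C n m‖ ^ 2) (‖C (lp.single 2 m 1)‖ ^ 2) :=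
      fun m => hasSum_norm_sq _
    constructor
    · rintro ⟨-, h⟩
      refine h.congr fun m => ?_
      exact (h1 m).tsum_eq
    · intro h
      refine ⟨fun m => (h1 m).summable, h.congr fun m => ?_⟩
      exact (h1 m).tsum_eq.symm
  rw [key] at hA ⊢
  refine Summable.of_nonneg_of_le (fun _ => by positivity) (fun m => ?_) (hA.mul_left (‖B‖ ^ 2))
  rw [← mul_pow]
  gcongr
  exact B.le_opNorm _

/-! ### The free resolvents -/

/-- The inverse shift. -/
def shiftInv : EllTwo →L[ℂ] EllTwo :=
  LinearMap.mkContinuous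
    { toFun := fun f => ⟨fun n => f (n - 1), memlp_of_summable
        (hasSum_comp_subRight (hasSum_norm_sq f) 1).summable⟩
      map_add' := fun _ _ => rfl
      map_smul' := fun _ _ => rfl }
    1
    (fun f => by
      rw [one_mul]
      exact norm_le_of_forall_sq_le (norm_nonneg f)
        (hasSum_comp_subRight (hasSum_norm_sq f) 1) fun n => le_rfl)

theorem shiftInv_apply (f : EllTwo) (n : ℤ) : shiftInv f n = f (n - 1) := rfl

theorem shift_mul_shiftInv : shift * shiftInv = 1 := by
  ext f n
  simp [shiftInv_apply]

theorem shiftInv_mul_shift : shiftInv * shift = 1 := by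
  ext f n
  simp [shiftInv_apply]

theorem norm_shiftInv_le : ‖shiftInv‖ ≤ 1 := LinearMap.mkContinuous_norm_le _ zero_le_one _

theorem norm_shift_le : ‖shift‖ ≤ 1 := LinearMap.mkContinuous_norm_le _ zero_le_one _

theorem isUnit_shift_sub {w : ℂ} (hw : ‖w‖ < 1) :
    IsUnit (shift - w • (1 : EllTwo →L[ℂ] EllTwo)) := by
  have h1 : IsUnit shift := ⟨⟨shift, shiftInv, shift_mul_shiftInv, shiftInv_mul_shift⟩, rfl⟩
  have h2 : IsUnit (1 - w • shiftInv) := by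
    refine isUnit_one_sub_of_norm_lt_one ?_
    rw [norm_smul]
    nlinarith [norm_shiftInv_le, norm_nonneg w, norm_nonneg shiftInv]
  have h3 : shift - w • (1 : EllTwo →L[ℂ] EllTwo) = shift * (1 - w • shiftInv) := by
    rw [mul_sub, mul_one, mul_smul_comm, shift_mul_shiftInv]
  rw [h3]
  exact h1.mul h2

theorem isUnit_sub_shift {z : ℂ} (hz : 1 < ‖z‖) :
    IsUnit (z • (1 : EllTwo →L[ℂ] EllTwo) - shift) := by
  have hz0 : z ≠ 0 := by
    rintro rfl
    simp at hz
    linarith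
  have h2 : IsUnit (1 - z⁻¹ • shift) := by
    refine isUnit_one_sub_of_norm_lt_one ?_
    rw [norm_smul, norm_inv]
    have : ‖z‖⁻¹ < 1 := inv_lt_one_of_one_lt₀ hz
    nlinarith [norm_shift_le, inv_nonneg.mpr (norm_nonneg z), norm_nonneg shift]
  have h3 : z • (1 : EllTwo →L[ℂ] EllTwo) - shift = (Units.mk0 z hz0) • (1 - z⁻¹ • shift) := by
    rw [Units.smul_def, Units.val_mk0, smul_sub, smul_smul, mul_inv_cancel₀ hz0, one_smul]
  rw [h3]
  exact h2.smul _

/-- The resolvent `(S - z⁻¹)⁻¹`. -/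
def resP (z : ℂ) : EllTwo →L[ℂ] EllTwo := Ring.inverse (shift - z⁻¹ • (1 : EllTwo →L[ℂ] EllTwo))

/-- The resolvent `(z - S)⁻¹`. -/
def resM (z : ℂ) : EllTwo →L[ℂ] EllTwo := Ring.inverse (z • (1 : EllTwo →L[ℂ] EllTwo) - shift)

/-- The convolution kernel of `(S - z⁻¹)⁻¹`. -/
def kerP (z : ℂ) (d : ℤ) : ℂ := if 0 < d then z⁻¹ ^ (d - 1).toNat else 0

/-- The convolution kernel of `(z - S)⁻¹`. -/
def kerM (z : ℂ) (d : ℤ) : ℂ := if d ≤ 0 then z⁻¹ ^ (1 - d).toNat else 0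

section Resolvents

variable {z : ℂ}

theorem norm_inv_lt_one (hz : 1 < ‖z‖) : ‖z⁻¹‖ < 1 := by
  rw [norm_inv]
  exact inv_lt_one_of_one_lt₀ hz

theorem hasSum_kerP (hz : 1 < ‖z‖) :
    HasSum (fun d => ‖kerP z d‖ ^ 2) (1 - ‖z⁻¹‖ ^ 2)⁻¹ := by
  have hw := norm_inv_lt_one hz
  have hinj : Function.Injective fun k : ℕ => (k : ℤ) + 1 := fun a b h => by
    simpa using h
  rw [← hinj.hasSum_iff]
  · have h := hasSum_geometric_of_lt_one (r := ‖z⁻¹‖ ^ 2) (by positivity)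
      (by nlinarith [norm_nonneg z⁻¹])
    convert h using 2 with k
    have : (0 : ℤ) < (k : ℤ) + 1 := by positivity
    simp only [Function.comp, kerP, if_pos this, norm_pow, ← pow_mul]
    congr 1
    simp [mul_comm]
  · intro d hd
    have : ¬ 0 < d := fun h0 => hd ⟨(d - 1).toNat, by simp only; omega⟩
    simp [kerP, this]

theorem hasSum_kerM (hz : 1 < ‖z‖) :
    HasSum (fun d => ‖kerM z d‖ ^ 2) (‖z⁻¹‖ ^ 2 * (1 - ‖z⁻¹‖ ^ 2)⁻¹) := by
  have hw := norm_inv_lt_one hz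
  have hinj : Function.Injective fun k : ℕ => -(k : ℤ) := fun a b h => by
    simpa using h
  rw [← hinj.hasSum_iff]
  · have h := (hasSum_geometric_of_lt_one (r := ‖z⁻¹‖ ^ 2) (by positivity)
      (by nlinarith [norm_nonneg z⁻¹])).mul_left (‖z⁻¹‖ ^ 2)
    refine hasSum_of_eq h fun k => ?_
    have : -(k : ℤ) ≤ 0 := by simp
    simp only [Function.comp, kerM, if_pos this, norm_pow, ← pow_mul, ← pow_add]
    congr 1
    omega
  · intro d hd
    have : ¬ d ≤ 0 := fun h0 => hd ⟨(-d).toNat, by simp only; omega⟩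
    simp [kerM, this]

theorem sub_mul_resP (hz : 1 < ‖z‖) :
    (shift - z⁻¹ • (1 : EllTwo →L[ℂ] EllTwo)) * resP z = 1 :=
  Ring.mul_inverse_cancel _ (isUnit_shift_sub (norm_inv_lt_one hz))

theorem resP_mul_sub (hz : 1 < ‖z‖) :
    resP z * (shift - z⁻¹ • (1 : EllTwo →L[ℂ] EllTwo)) = 1 :=
  Ring.inverse_mul_cancel _ (isUnit_shift_sub (norm_inv_lt_one hz))

theorem sub_mul_resM (hz : 1 < ‖z‖) :
    (z • (1 : EllTwo →L[ℂ] EllTwo) - shift) * resM z = 1 :=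
  Ring.mul_inverse_cancel _ (isUnit_sub_shift hz)

theorem resM_mul_sub (hz : 1 < ‖z‖) :
    resM z * (z • (1 : EllTwo →L[ℂ] EllTwo) - shift) = 1 :=
  Ring.inverse_mul_cancel _ (isUnit_sub_shift hz)

/-- The column of the kernel solves the resolvent equation, and the left inverse identifies it with
the column of the resolvent. Row `n` of `resP z` sees only the sites m < n, and row `n` of `resM z`
only the sites m ≥ n; the boundary computations depend on this one-sidedness. -/
theorem entry_resP (hz : 1 < ‖z‖) (n m : ℤ) : entry (resP z) n m = kerP z (n - m) := by
  let v : EllTwo := ⟨fun n => kerP z (n - m), memlp_of_summable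
    (hasSum_comp_subRight (hasSum_kerP hz) m).summable⟩
  have hv : (shift - z⁻¹ • (1 : EllTwo →L[ℂ] EllTwo)) v = lp.single 2 m 1 := by
    ext n
    rw [single_one_apply]
    change kerP z (n + 1 - m) - z⁻¹ * kerP z (n - m) = _
    rcases lt_trichotomy n m with h | h | h
    · rw [kerP, kerP, if_neg (by omega), if_neg (by omega), if_neg (by omega)]
      simp
    · subst h
      simp [kerP]
    · rw [kerP, kerP, if_pos (by omega), if_pos (by omega), if_neg (by omega), ← pow_succ',
        show (n + 1 - m - 1).toNat = (n - m - 1).toNat + 1 by omega, sub_self]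
  have : resP z (lp.single 2 m 1) = v := by
    rw [← hv, ← mul_apply_eq_comp, resP_mul_sub hz]
    rfl
  rw [entry, this]

theorem entry_resM (hz : 1 < ‖z‖) (n m : ℤ) : entry (resM z) n m = kerM z (n - m) := by
  have hz0 : z ≠ 0 := by
    rintro rfl
    simp at hz
    linarith
  let v : EllTwo := ⟨fun n => kerM z (n - m), memlp_of_summable
    (hasSum_comp_subRight (hasSum_kerM hz) m).summable⟩
  have hv : (z • (1 : EllTwo →L[ℂ] EllTwo) - shift) v = lp.single 2 m 1 := by
    ext n
    rw [single_one_apply]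
    change z * kerM z (n - m) - kerM z (n + 1 - m) = _
    rcases lt_trichotomy n m with h | h | h
    · rw [kerM, kerM, if_pos (by omega), if_pos (by omega), if_neg (by omega),
        show (1 - (n - m)).toNat = (1 - (n + 1 - m)).toNat + 1 by omega, pow_succ', ← mul_assoc,
        mul_inv_cancel₀ hz0, one_mul, sub_self]
    · subst h
      simp [kerM, hz0]
    · rw [kerM, kerM, if_neg (by omega), if_neg (by omega), if_neg (by omega)]
      simp
  have : resM z (lp.single 2 m 1) = v := by
    rw [← hv, ← mul_apply_eq_comp, resM_mul_sub hz]
    rfl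
  rw [entry, this]

end Resolvents

/-! ### The operator `Λ Γ` with independent coefficients -/

/-- The map from sequences to multiplication operators. -/
def mulOpCLM : EllTwo →L[ℂ] EllTwo →L[ℂ] EllTwo :=
  LinearMap.mkContinuous
    { toFun := mulOp
      map_add' := fun a b => by ext f n; exact add_mul (a n) (b n) (f n)
      map_smul' := fun c a => by ext f n; exact mul_assoc c (a n) (f n) }
    1
    (fun a => by
      refine ContinuousLinearMap.opNorm_le_bound _ (by positivity) fun f => ?_
      refine norm_le_of_forall_sq_le (g := fun n => ‖a‖ ^ 2 * ‖f n‖ ^ 2) (by positivity) ?_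
        fun n => ?_
      · rw [one_mul, mul_pow]
        exact (hasSum_norm_sq f).mul_left _
      · rw [← mul_pow]
        refine pow_le_pow_left₀ (norm_nonneg _) ?_ 2
        refine (norm_mul_le (a n) (f n)).trans ?_
        exact mul_le_mul_of_nonneg_right (norm_apply_le a n) (norm_nonneg _))

@[simp] theorem mulOpCLM_apply (a : EllTwo) : mulOpCLM a = mulOp a := rfl

/-- The operator `a (S - z⁻¹)⁻¹ b (z - S)⁻¹`. -/
def opU (z : ℂ) (a b : EllTwo) : EllTwo →L[ℂ] EllTwo := mulOp a * resP z * (mulOp b * resM z)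

/-- The series `∑ (-1)^{ℓ+1} / ℓ tr {U^ℓ}` with `U = a (S - z⁻¹)⁻¹ b (z - S)⁻¹`. -/
def logTrace (z : ℂ) (a b : EllTwo) : ℂ :=
  ∑' k : ℕ, (-1) ^ (k + 2) / ((k : ℂ) + 1) * trace (opU z a b ^ (k + 1))

/-- The number `|z|⁻¹ / (1 - |z|⁻²) = 1 / (|z| - |z|⁻¹)`. -/
def resConst (z : ℂ) : ℝ := ‖z⁻¹‖ / (1 - ‖z⁻¹‖ ^ 2)

/-- Makes the operator algebra a `NormOneClass`, so that `norm_pow_le` covers the exponent 0. -/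
instance : Nontrivial EllTwo :=
  ⟨⟨lp.single 2 0 1, 0, fun h => by simpa [h] using norm_single_one 0⟩⟩

theorem pow_mul_rotate {M : Type*} [Monoid M] (x y : M) (k : ℕ) :
    (x * y) ^ k * x = x * (y * x) ^ k := by
  induction k with
  | zero => simp
  | succ k ih => rw [pow_succ', mul_assoc, ih, pow_succ', mul_assoc, mul_assoc]

section

variable {z : ℂ}

/-- `cP` and `cM` are the ℓ² norms of the two kernels. For |z| = e^y their product is 1 / (2 sinh
y), of order 1 / y as y → 0, whereas a product of resolvent norms would be of order 1 / y². -/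
theorem exists_resConst_factor (hz : 1 < ‖z‖) : ∃ cP cM : ℝ, 0 ≤ cP ∧ 0 ≤ cM ∧
    HasSum (fun d => ‖kerP z d‖ ^ 2) (cP ^ 2) ∧ HasSum (fun d => ‖kerM z d‖ ^ 2) (cM ^ 2) ∧
    cP * cM = resConst z := by
  have hw := norm_inv_lt_one hz
  have h0 : 0 ≤ (1 - ‖z⁻¹‖ ^ 2)⁻¹ := by
    rw [inv_nonneg]
    nlinarith [norm_nonneg z⁻¹]
  refine ⟨√(1 - ‖z⁻¹‖ ^ 2)⁻¹, ‖z⁻¹‖ * √(1 - ‖z⁻¹‖ ^ 2)⁻¹, by positivity, by positivity, ?_, ?_, ?_⟩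
  · rw [Real.sq_sqrt h0]
    exact hasSum_kerP hz
  · rw [mul_pow, Real.sq_sqrt h0]
    exact hasSum_kerM hz
  · rw [mul_left_comm, Real.mul_self_sqrt h0, resConst, div_eq_mul_inv]

theorem resConst_nonneg (hz : 1 < ‖z‖) : 0 ≤ resConst z := by
  obtain ⟨cP, cM, hP, hM, -, -, h⟩ := exists_resConst_factor hz
  rw [← h]
  positivity

theorem norm_opU_le (hz : 1 < ‖z‖) (a b : EllTwo) : ‖opU z a b‖ ≤ ‖a‖ * ‖b‖ * resConst z := by
  obtain ⟨cP, cM, hP, hM, hgP, hgM, h⟩ := exists_resConst_factor hz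
  have h1 := norm_mulOp_conv_le (entry_resP hz) hP hgP a
  have h2 := norm_mulOp_conv_le (entry_resM hz) hM hgM b
  calc ‖opU z a b‖ ≤ ‖mulOp a * resP z‖ * ‖mulOp b * resM z‖ := norm_mul_le _ _
    _ ≤ ‖a‖ * cP * (‖b‖ * cM) := by gcongr
    _ = _ := by rw [← h]; ring

theorem isTraceClass_opU_pow (hz : 1 < ‖z‖) (a b : EllTwo) (k : ℕ) :
    IsTraceClass (opU z a b ^ (k + 1)) := by
  obtain ⟨cP, cM, hP, hM, hgP, hgM, h⟩ := exists_resConst_factor hz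
  refine ⟨opU z a b ^ k * (mulOp a * resP z), mulOp b * resM z, ?_, ?_, ?_⟩
  · exact (isHilbertSchmidt_mulOp_conv (entry_resP hz) hgP a).mul_left _
  · exact isHilbertSchmidt_mulOp_conv (entry_resM hz) hgM b
  · rw [pow_succ, mul_assoc]
    rfl

theorem norm_le_of_forall_norm_le {a a' : EllTwo} (h : ∀ n, ‖a' n‖ ≤ ‖a n‖) : ‖a'‖ ≤ ‖a‖ :=
  norm_le_of_forall_sq_le (norm_nonneg a) (hasSum_norm_sq a)
    fun n => pow_le_pow_left₀ (norm_nonneg _) (h n) 2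

/-- Termwise bounds for the traces of the powers, uniform over dominated coefficients. -/
theorem exists_trace_dominant (hz : 1 < ‖z‖) (a b : EllTwo) :
    ∃ D : ℤ → ℝ, Summable D ∧ ∑' n, D n ≤ ‖a‖ * ‖b‖ * resConst z ∧
      ∀ (a' b' : EllTwo), (∀ n, ‖a' n‖ ≤ ‖a n‖) → (∀ n, ‖b' n‖ ≤ ‖b n‖) → ∀ (k : ℕ) (n : ℤ),
        ‖entry (opU z a' b' ^ (k + 1)) n n‖ ≤ (‖a‖ * ‖b‖ * resConst z) ^ k * D n := by
  obtain ⟨cP, cM, hP, hM, hgP, hgM, h⟩ := exists_resConst_factor hz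
  have hG := hasSum_norm_sq_mulOp_conv_single (entry_resM hz) hgM b
  have ha := hasSum_norm_sq a
  obtain ⟨C, -, hC, hs⟩ := Real.inner_le_Lp_mul_Lq_hasSum_of_nonneg (p := 2) (q := 2)
    (f := fun m => ‖a m‖) (g := fun m => ‖(mulOp b * resM z) (lp.single 2 m 1)‖)
    (A := ‖a‖) (B := ‖b‖ * cM) (by rw [Real.holderConjugate_iff]; norm_num) (norm_nonneg a)
    (by positivity) (fun _ => norm_nonneg _) (fun _ => norm_nonneg _) (by simpa using ha)
    (by simpa using hG)
  -- Row `n` of Λ contributes `cP * ‖a n‖` and column `n` of Γ its norm; Cauchy–Schwarz over `n` has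
  -- just bounded the sum of the products.
  refine ⟨fun n => cP * (‖a n‖ * ‖(mulOp b * resM z) (lp.single 2 n 1)‖), hs.summable.mul_left cP,
    ?_, ?_⟩
  · rw [(hs.mul_left cP).tsum_eq, ← h]
    nlinarith
  · intro a' b' ha' hb' k n
    have hna := norm_le_of_forall_norm_le ha'
    have hnb := norm_le_of_forall_norm_le hb'
    have hL := norm_mulOp_conv_le (entry_resP hz) hP hgP a'
    have hM' := norm_mulOp_conv_le (entry_resM hz) hM hgM b'
    -- (ΛΓ)^{k+1} = Λ (ΓΛ)^k Γ puts Λ at the row index and Γ at the column index, which leaves only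
    -- an operator norm for the middle factor.
    have hrot : opU z a' b' ^ (k + 1) = mulOp a' * resP z *
        ((mulOp b' * resM z * (mulOp a' * resP z)) ^ k * (mulOp b' * resM z)) := by
      rw [opU, pow_succ, ← mul_assoc (_ ^ k) (mulOp a' * resP z), pow_mul_rotate,
        mul_assoc (mulOp a' * resP z)]
    have h1 : ‖(mulOp b' * resM z) (lp.single 2 n 1)‖ ≤ ‖(mulOp b * resM z) (lp.single 2 n 1)‖ := by
      refine norm_le_of_forall_norm_le fun m => ?_
      rw [mul_apply_eq_comp, mul_apply_eq_comp, mulOp_apply, mulOp_apply, norm_mul, norm_mul]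
      exact mul_le_mul_of_nonneg_right (hb' m) (norm_nonneg _)
    have h2 : ‖(mulOp b' * resM z * (mulOp a' * resP z)) ^ k‖ ≤ (‖a‖ * ‖b‖ * resConst z) ^ k := by
      refine (norm_pow_le _ k).trans ?_
      refine pow_le_pow_left₀ (norm_nonneg _) ?_ k
      calc _ ≤ ‖mulOp b' * resM z‖ * ‖mulOp a' * resP z‖ := norm_mul_le _ _
        _ ≤ ‖b'‖ * cM * (‖a'‖ * cP) := by gcongr
        _ ≤ ‖b‖ * cM * (‖a‖ * cP) := by gcongr
        _ = _ := by rw [← h]; ring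
    have h3 := norm_mulOp_conv_apply_le (entry_resP hz) hP hgP a'
      (((mulOp b' * resM z * (mulOp a' * resP z)) ^ k * (mulOp b' * resM z)) (lp.single 2 n 1)) n
    have h4 : ‖((mulOp b' * resM z * (mulOp a' * resP z)) ^ k * (mulOp b' * resM z))
        (lp.single 2 n 1)‖ ≤
        (‖a‖ * ‖b‖ * resConst z) ^ k * ‖(mulOp b * resM z) (lp.single 2 n 1)‖ := by
      rw [mul_apply_eq_comp]
      refine (ContinuousLinearMap.le_opNorm _ _).trans ?_
      exact mul_le_mul h2 h1 (norm_nonneg _) ((norm_nonneg _).trans h2)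
    have hq : 0 ≤ (‖a‖ * ‖b‖ * resConst z) ^ k := (norm_nonneg _).trans h2
    calc ‖entry (opU z a' b' ^ (k + 1)) n n‖ ≤ _ := by rw [hrot]; exact h3
      _ ≤ ‖a n‖ * (cP * ((‖a‖ * ‖b‖ * resConst z) ^ k *
          ‖(mulOp b * resM z) (lp.single 2 n 1)‖)) :=
        mul_le_mul (ha' n) (mul_le_mul_of_nonneg_left h4 hP) (by positivity) (norm_nonneg _)
      _ = _ := by ring

theorem norm_trace_opU_pow_le (hz : 1 < ‖z‖) (a b : EllTwo) (k : ℕ) :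
    ‖trace (opU z a b ^ (k + 1))‖ ≤ (‖a‖ * ‖b‖ * resConst z) ^ (k + 1) := by
  obtain ⟨D, hD, hD1, h⟩ := exists_trace_dominant hz a b
  have hq : 0 ≤ ‖a‖ * ‖b‖ * resConst z := by have := resConst_nonneg hz; positivity
  refine (tsum_of_norm_bounded (hD.hasSum.mul_left ((‖a‖ * ‖b‖ * resConst z) ^ k)) fun n =>
    h a b (fun _ => le_rfl) (fun _ => le_rfl) k n).trans ?_
  rw [pow_succ]
  exact mul_le_mul_of_nonneg_left hD1 (pow_nonneg hq k)

theorem norm_logCoeff_le (k : ℕ) : ‖((-1) ^ (k + 2) / ((k : ℂ) + 1) : ℂ)‖ ≤ 1 := by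
  rw [norm_div, norm_pow, norm_neg, norm_one, one_pow,
    show ((k : ℂ) + 1) = ((k + 1 : ℕ) : ℂ) by push_cast; ring, Complex.norm_natCast]
  exact div_le_one_of_le₀ (by exact_mod_cast Nat.succ_le_succ (Nat.zero_le k)) (by positivity)

theorem norm_logTrace_term_le (hz : 1 < ‖z‖) (a b : EllTwo) (k : ℕ) :
    ‖(-1) ^ (k + 2) / ((k : ℂ) + 1) * trace (opU z a b ^ (k + 1))‖ ≤
      (‖a‖ * ‖b‖ * resConst z) ^ (k + 1) := by
  rw [norm_mul]
  have h1 := norm_trace_opU_pow_le hz a b k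
  have h2 := norm_logCoeff_le k
  calc _ ≤ 1 * (‖a‖ * ‖b‖ * resConst z) ^ (k + 1) :=
        mul_le_mul h2 h1 (norm_nonneg _) zero_le_one
    _ = _ := one_mul _

theorem summable_logTrace (hz : 1 < ‖z‖) {a b : EllTwo} (hq : ‖a‖ * ‖b‖ * resConst z < 1) :
    Summable fun k : ℕ => (-1) ^ (k + 2) / ((k : ℂ) + 1) * trace (opU z a b ^ (k + 1)) := by
  have hq0 : 0 ≤ ‖a‖ * ‖b‖ * resConst z := by have := resConst_nonneg hz; positivity
  exact Summable.of_norm_bounded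
    ((summable_nat_add_iff 1).mpr (summable_geometric_of_lt_one hq0 hq))
    (norm_logTrace_term_le hz a b)

/-- The terms ℓ ≥ 2 are dominated by q² / (1 - q), with q ≤ 1/2. -/
theorem norm_logTrace_sub_trace_le (hz : 1 < ‖z‖) {a b : EllTwo}
    (hq : ‖a‖ * ‖b‖ * resConst z ≤ 1 / 2) :
    ‖logTrace z a b - trace (opU z a b)‖ ≤ 2 * (‖a‖ * ‖b‖ * resConst z) ^ 2 := by
  have hq0 : 0 ≤ ‖a‖ * ‖b‖ * resConst z := by have := resConst_nonneg hz; positivity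
  have hs := summable_logTrace hz (hq.trans_lt (by norm_num))
  have h1 := hs.tsum_eq_zero_add
  have h2 : logTrace z a b - trace (opU z a b) = ∑' k : ℕ, (-1) ^ (k + 1 + 2) /
      (((k + 1 : ℕ) : ℂ) + 1) * trace (opU z a b ^ (k + 1 + 1)) := by
    rw [logTrace, h1]
    norm_num
  have hg := (hasSum_geometric_of_lt_one hq0 (hq.trans_lt (by norm_num))).mul_left
    ((‖a‖ * ‖b‖ * resConst z) ^ 2)
  rw [h2]
  refine (tsum_of_norm_bounded hg fun k => ?_).trans ?_
  · refine (norm_logTrace_term_le hz a b (k + 1)).trans_eq ?_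
    ring
  · rw [mul_comm 2]
    gcongr
    rw [inv_le_comm₀ (by linarith) (by norm_num)]
    linarith

theorem tendsto_opU (z : ℂ) {ι : Type*} {l : Filter ι} {a b : EllTwo} {a' b' : ι → EllTwo}
    (ha : Filter.Tendsto a' l (nhds a)) (hb : Filter.Tendsto b' l (nhds b)) :
    Filter.Tendsto (fun i => opU z (a' i) (b' i)) l (nhds (opU z a b)) := by
  have h1 : Filter.Tendsto (fun i => mulOp (a' i)) l (nhds (mulOp a)) :=
    (mulOpCLM.continuous.tendsto a).comp ha
  have h2 : Filter.Tendsto (fun i => mulOp (b' i)) l (nhds (mulOp b)) :=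
    (mulOpCLM.continuous.tendsto b).comp hb
  exact (h1.mul_const (resP z)).mul (h2.mul_const (resM z))

/-- Dominated convergence twice: over the sites for each power, with the majorant of
`exists_trace_dominant`, then over the powers, with a geometric majorant. It removes the truncation.
-/
theorem tendsto_logTrace (hz : 1 < ‖z‖) {a b : EllTwo} (hq : ‖a‖ * ‖b‖ * resConst z < 1)
    {ι : Type*} {l : Filter ι} {a' b' : ι → EllTwo} (ha : Filter.Tendsto a' l (nhds a))
    (hb : Filter.Tendsto b' l (nhds b)) (ha' : ∀ i n, ‖a' i n‖ ≤ ‖a n‖)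
    (hb' : ∀ i n, ‖b' i n‖ ≤ ‖b n‖) :
    Filter.Tendsto (fun i => logTrace z (a' i) (b' i)) l (nhds (logTrace z a b)) := by
  have hq0 : 0 ≤ ‖a‖ * ‖b‖ * resConst z := by have := resConst_nonneg hz; positivity
  obtain ⟨D, hD, hD1, h⟩ := exists_trace_dominant hz a b
  have hU := tendsto_opU z ha hb
  have htr : ∀ k : ℕ, Filter.Tendsto (fun i => trace (opU z (a' i) (b' i) ^ (k + 1))) l
      (nhds (trace (opU z a b ^ (k + 1)))) := fun k => by
    refine tendsto_tsum_of_dominated_convergence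
      (bound := fun n => (‖a‖ * ‖b‖ * resConst z) ^ k * D n) (hD.mul_left _)
      (fun n => ?_) (.of_forall fun i n => h _ _ (ha' i) (hb' i) k n)
    exact ((entryCLM n n).continuous.tendsto _).comp (hU.pow (k + 1))
  have hsum : Summable fun k : ℕ => (‖a‖ * ‖b‖ * resConst z) ^ (k + 1) :=
    (summable_nat_add_iff (f := fun k : ℕ => (‖a‖ * ‖b‖ * resConst z) ^ k) 1).mpr
      (summable_geometric_of_lt_one hq0 hq)
  refine tendsto_tsum_of_dominated_convergence hsum (fun k => (htr k).const_mul _)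
    (.of_forall fun i k => ?_)
  refine (norm_logTrace_term_le hz _ _ k).trans ?_
  have h1 := resConst_nonneg hz
  have h2 := norm_le_of_forall_norm_le (ha' i)
  have h3 := norm_le_of_forall_norm_le (hb' i)
  refine pow_le_pow_left₀ (by positivity) ?_ _
  exact mul_le_mul_of_nonneg_right (mul_le_mul h2 h3 (norm_nonneg _) (norm_nonneg _)) h1

end

/-! ### Truncation -/

/-- The projection to the sites in `F`. -/
def proj (F : Finset ℤ) : EllTwo →L[ℂ] EllTwo :=
  ∑ n ∈ F, (coord n).smulRight (lp.single 2 n (1 : ℂ) : EllTwo)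

theorem proj_apply_eq_sum (F : Finset ℤ) (f : EllTwo) :
    proj F f = ∑ n ∈ F, f n • (lp.single 2 n (1 : ℂ) : EllTwo) := by
  simp [proj]

theorem proj_apply (F : Finset ℤ) (f : EllTwo) (n : ℤ) :
    proj F f n = if n ∈ F then f n else 0 := by
  rw [proj_apply_eq_sum, sum_apply]
  simp only [lp.coeFn_smul, Pi.smul_apply, single_one_apply, smul_eq_mul, mul_ite, mul_one,
    mul_zero]
  simp

theorem norm_proj_apply_le (F : Finset ℤ) (f : EllTwo) (n : ℤ) : ‖proj F f n‖ ≤ ‖f n‖ := by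
  rw [proj_apply]
  split_ifs <;> simp

theorem norm_proj_le (F : Finset ℤ) : ‖proj F‖ ≤ 1 :=
  ContinuousLinearMap.opNorm_le_bound _ zero_le_one fun f => by
    rw [one_mul]
    exact norm_le_of_forall_norm_le (norm_proj_apply_le F f)

theorem tendsto_proj (f : EllTwo) :
    Filter.Tendsto (fun K : ℕ => proj (Finset.Icc (-(K : ℤ)) K) f) Filter.atTop (nhds f) := by
  have h : HasSum (fun n => f n • (lp.single 2 n (1 : ℂ) : EllTwo)) f :=
    hasSum_of_eq (lp.hasSum_single (by norm_num) f) fun n => (single_eq_smul n _).symm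
  simp only [proj_apply_eq_sum]
  exact Filter.Tendsto.comp (g := fun F : Finset ℤ => ∑ n ∈ F, f n • (lp.single 2 n (1 : ℂ) : EllTwo))
    h Finset.tendsto_Icc_neg

theorem beta_apply (s : ℝ) (a : EllTwo) (n : ℤ) : beta s a n = s * conj (a n) := rfl

theorem norm_beta_apply {s : ℝ} (hs : s = 1 ∨ s = -1) (a : EllTwo) (n : ℤ) :
    ‖beta s a n‖ = ‖a n‖ := by
  rw [beta_apply, norm_mul, RCLike.norm_conj]
  rcases hs with rfl | rfl <;> simp

theorem norm_beta {s : ℝ} (hs : s = 1 ∨ s = -1) (a : EllTwo) : ‖beta s a‖ = ‖a‖ :=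
  le_antisymm (norm_le_of_forall_norm_le fun n => (norm_beta_apply hs a n).le)
    (norm_le_of_forall_norm_le fun n => (norm_beta_apply hs a n).ge)

/-! ### The derivative of `∑ (-1)^{ℓ+1} / ℓ τ(U^ℓ)` in a Banach algebra -/

section LogSeries

variable {A : Type*} [NormedRing A] [NormedAlgebra ℂ A]

/-- U' need not commute with U, so the derivative of a power simplifies only under τ. The extra
factor `U t ^ j` is the strengthening that lets the induction on `k` close; j = 0 is the case of
interest. -/
theorem exists_hasDerivAt_pow_of_tracial (τ : A →L[ℂ] ℂ) {U : ℝ → A} {u' : A} {t : ℝ}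
    (hU : HasDerivAt U u' t) (hτ : ∀ x, τ (U t * x) = τ (x * U t)) (k : ℕ) :
    ∃ d : A, HasDerivAt (fun t => U t ^ (k + 1)) d t ∧
      ∀ j : ℕ, τ (d * U t ^ j) = ((k : ℂ) + 1) * τ (U t ^ (k + j) * u') := by
  have hpow : ∀ (j : ℕ) (x : A), τ (x * U t ^ j) = τ (U t ^ j * x) := fun j => by
    induction j with
    | zero => simp
    | succ j ih =>
      intro x
      rw [pow_succ, ← mul_assoc, ← hτ, ← mul_assoc, ih, mul_assoc]
  induction k with
  | zero =>
    refine ⟨u', by simpa using hU, fun j => ?_⟩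
    simp [hpow]
  | succ k ih =>
    obtain ⟨d, hd, h⟩ := ih
    refine ⟨d * U t + U t ^ (k + 1) * u', ?_, fun j => ?_⟩
    · have e : (fun t => U t ^ (k + 1 + 1)) = fun t => U t ^ (k + 1) * U t :=
        funext fun t => pow_succ _ _
      rw [e]
      exact hd.mul hU
    · rw [add_mul, map_add, mul_assoc, ← pow_succ', h, hpow, ← mul_assoc, ← pow_add,
        show j + (k + 1) = k + 1 + j by ring, show k + (j + 1) = k + 1 + j by ring]
      push_cast
      ring

/-- Termwise differentiation cancels the factors 1/ℓ and leaves τ(∑ (-U)^k U'), a Neumann series.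
Cyclicity is required only against `U t` itself, which is what a partial trace can offer. -/
theorem hasDerivAt_log_series [CompleteSpace A] [NormOneClass A] (τ : A →L[ℂ] ℂ) {U U' : ℝ → A}
    {r : ℝ} (hr : r < 1) (hU : ∀ t, HasDerivAt U (U' t) t) (hUr : ∀ t, ‖U t‖ ≤ r)
    (hU' : Continuous U') (hτ : ∀ t x, τ (U t * x) = τ (x * U t)) (t : ℝ) :
    HasDerivAt (fun t => ∑' k : ℕ, (-1) ^ (k + 2) / ((k : ℂ) + 1) * τ (U t ^ (k + 1)))
      (τ (Ring.inverse (1 + U t) * U' t)) t := by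
  have hr0 : 0 ≤ r := (norm_nonneg _).trans (hUr 0)
  have hpow : ∀ t k, ‖U t ^ k‖ ≤ r ^ k := fun t k =>
    (norm_pow_le _ k).trans (pow_le_pow_left₀ (norm_nonneg _) (hUr t) k)
  have hterm : ∀ (k : ℕ) (t : ℝ), HasDerivAt
      (fun t => (-1) ^ (k + 2) / ((k : ℂ) + 1) * τ (U t ^ (k + 1)))
      ((-1) ^ k * τ (U t ^ k * U' t)) t := fun k t => by
    obtain ⟨d, hd, h⟩ := exists_hasDerivAt_pow_of_tracial τ (hU t) (hτ t) k
    have h1 := ((τ.restrictScalars ℝ).hasFDerivAt.comp_hasDerivAt t hd).const_mul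
      ((-1) ^ (k + 2) / ((k : ℂ) + 1))
    have h0 := h 0
    rw [pow_zero, mul_one, add_zero] at h0
    refine h1.congr_deriv ?_
    change (-1) ^ (k + 2) / ((k : ℂ) + 1) * τ d = _
    rw [h0]
    have : (k : ℂ) + 1 ≠ 0 := Nat.cast_add_one_ne_zero k
    field_simp
    ring
  -- Continuity bounds U' on a small ball around `t`, which is enough for a uniform majorant of the
  -- differentiated series.
  obtain ⟨ε, hε, hball⟩ := Metric.continuousAt_iff.mp hU'.continuousAt 1 one_pos
  have hB : ∀ y ∈ Metric.ball t ε, ‖U' y‖ ≤ ‖U' t‖ + 1 := fun y hy => by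
    have h1 := hball hy
    rw [dist_eq_norm] at h1
    have h2 := norm_add_le (U' y - U' t) (U' t)
    rw [sub_add_cancel] at h2
    linarith
  have hu : Summable fun k : ℕ => ‖τ‖ * (r ^ k * (‖U' t‖ + 1)) :=
    ((summable_geometric_of_lt_one hr0 hr).mul_right _).mul_left _
  have hs0 : Summable fun k : ℕ => (-1) ^ (k + 2) / ((k : ℂ) + 1) * τ (U t ^ (k + 1)) := by
    refine Summable.of_norm_bounded ((summable_geometric_of_lt_one hr0 hr).mul_left (‖τ‖ * r))
      fun k => ?_
    have h1 := norm_logCoeff_le k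
    have h2 : ‖τ (U t ^ (k + 1))‖ ≤ ‖τ‖ * r ^ (k + 1) :=
      (τ.le_opNorm _).trans (mul_le_mul_of_nonneg_left (hpow t _) (norm_nonneg τ))
    rw [norm_mul]
    calc _ ≤ 1 * (‖τ‖ * r ^ (k + 1)) := mul_le_mul h1 h2 (norm_nonneg _) zero_le_one
      _ = _ := by ring
  have key := hasDerivAt_tsum_of_isPreconnected hu Metric.isOpen_ball
    (convex_ball t ε).isPreconnected (fun k y _ => hterm k y) (fun k y hy => by
      rw [norm_mul, norm_pow, norm_neg, norm_one, one_pow, one_mul]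
      refine (τ.le_opNorm _).trans (mul_le_mul_of_nonneg_left ?_ (norm_nonneg τ))
      refine (norm_mul_le _ _).trans ?_
      exact mul_le_mul (hpow y k) (hB y hy) (norm_nonneg _) (pow_nonneg hr0 k))
    (Metric.mem_ball_self hε) hs0 (Metric.mem_ball_self hε)
  refine key.congr_deriv ?_
  have hlt : ‖-U t‖ < 1 := by
    rw [norm_neg]
    exact (hUr t).trans_lt hr
  have hinv : Ring.inverse (1 + U t) = ∑' k : ℕ, (-U t) ^ k := by
    rw [← sub_neg_eq_add, NormedRing.inverse_one_sub _ hlt]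
    rfl
  have hgeo : HasSum (fun k : ℕ => (-U t) ^ k) (∑' k : ℕ, (-U t) ^ k) :=
    (summable_geometric_of_norm_lt_one hlt).hasSum
  rw [hinv]
  refine HasSum.tsum_eq (hasSum_of_eq ((hgeo.mul_right (U' t)).mapL τ) fun k => ?_)
  rcases Nat.even_or_odd k with h | h <;> simp [h.neg_one_pow, h.neg_pow]

end LogSeries

/-! ### Algebra of the Green's function -/

/-- The blocks of the inverse of `[[Y, c], [d, -X]]` in terms of `P = X⁻¹`, `M = Y⁻¹` and
`D = (1 + c P d M)⁻¹`. -/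
theorem green_identities {A : Type*} [Ring A] {X Y P M c d D : A} (hXP : X * P = 1)
    (hPX : P * X = 1) (hYM : Y * M = 1) (hMY : M * Y = 1) (hD : (1 + c * P * (d * M)) * D = 1)
    (hD' : D * (1 + c * P * (d * M)) = 1) :
    (Y * (M * D) + c * (P * d * M * D) = 1 ∧
      d * (M * D) - X * (P * d * M * D) = 0 ∧
      Y * (M * D * c * P) + c * (P * d * M * D * c * P - P) = 0 ∧
      d * (M * D * c * P) - X * (P * d * M * D * c * P - P) = 1) ∧
    (M * D * Y + M * D * c * P * d = 1 ∧
      M * D * c - M * D * c * P * X = 0 ∧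
      P * d * M * D * Y + (P * d * M * D * c * P - P) * d = 0 ∧
      P * d * M * D * c - (P * d * M * D * c * P - P) * X = 1) := by
  have h1 : D + c * P * d * M * D = 1 := by rw [← hD]; noncomm_ring
  have h2 : D + D * c * P * d * M = 1 := by rw [← hD']; noncomm_ring
  have hY : M * D * Y + M * D * c * P * d = 1 := by
    calc _ = M * D * Y + M * D * c * P * d * (M * Y) := by rw [hMY, mul_one]
      _ = M * (D + D * c * P * d * M) * Y := by noncomm_ring
      _ = 1 := by rw [h2, mul_one, hMY]
  refine ⟨⟨?_, ?_, ?_, ?_⟩, hY, ?_, ?_, ?_⟩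
  · calc _ = (Y * M) * D + c * P * d * M * D := by noncomm_ring
      _ = 1 := by rw [hYM, one_mul, h1]
  · calc _ = d * M * D - (X * P) * d * M * D := by noncomm_ring
      _ = 0 := by rw [hXP, one_mul, sub_self]
  · calc _ = ((Y * M) * D + c * P * d * M * D) * c * P - c * P := by noncomm_ring
      _ = 0 := by rw [hYM, one_mul, h1, one_mul, sub_self]
  · calc _ = d * M * D * c * P - (X * P) * d * M * D * c * P + X * P := by noncomm_ring
      _ = 1 := by rw [hXP, one_mul, sub_self, zero_add]
  · calc _ = M * D * c - M * D * c * (P * X) := by noncomm_ring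
      _ = 0 := by rw [hPX, mul_one, sub_self]
  · calc _ = P * d * (M * D * Y + M * D * c * P * d) - P * d := by noncomm_ring
      _ = 0 := by rw [hY, mul_one, sub_self]
  · calc _ = P * d * M * D * c - P * d * M * D * c * (P * X) + P * X := by noncomm_ring
      _ = 1 := by rw [hPX, mul_one, sub_self, zero_add]

/-- The inverse of `1 + Λ Γ`. -/
def invU (z : ℂ) (c d : EllTwo) : EllTwo →L[ℂ] EllTwo := Ring.inverse (1 + opU z c d)

/-- The `(1,1)` block of the Green's function. -/
def green11 (z : ℂ) (c d : EllTwo) : EllTwo →L[ℂ] EllTwo := resM z * invU z c d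

/-- The `(1,2)` block of the Green's function. -/
def green12 (z : ℂ) (c d : EllTwo) : EllTwo →L[ℂ] EllTwo :=
  resM z * invU z c d * mulOp c * resP z

/-- The `(2,1)` block of the Green's function. -/
def green21 (z : ℂ) (c d : EllTwo) : EllTwo →L[ℂ] EllTwo :=
  resP z * mulOp d * resM z * invU z c d

/-- The `(2,2)` block of the Green's function. -/
def green22 (z : ℂ) (c d : EllTwo) : EllTwo →L[ℂ] EllTwo :=
  resP z * mulOp d * resM z * invU z c d * mulOp c * resP z - resP z

section Green

variable {z : ℂ} {c d : EllTwo}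

theorem isUnit_one_add {A : Type*} [NormedRing A] [CompleteSpace A] {x : A} (h : ‖x‖ < 1) :
    IsUnit (1 + x) := by
  rw [← sub_neg_eq_add]
  exact isUnit_one_sub_of_norm_lt_one (by rwa [norm_neg])

theorem invU_mul_cancel (hU : ‖opU z c d‖ < 1) : invU z c d * (1 + opU z c d) = 1 :=
  Ring.inverse_mul_cancel _ (isUnit_one_add hU)

theorem mul_invU_cancel (hU : ‖opU z c d‖ < 1) : (1 + opU z c d) * invU z c d = 1 :=
  Ring.mul_inverse_cancel _ (isUnit_one_add hU)

theorem norm_invU_le (hU : ‖opU z c d‖ ≤ 1 / 2) : ‖invU z c d‖ ≤ 2 := by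
  have h := mul_invU_cancel (hU.trans_lt (by norm_num))
  have h1 : invU z c d = 1 - opU z c d * invU z c d := by
    rw [eq_sub_iff_add_eq, ← h]
    noncomm_ring
  have h2 : ‖invU z c d‖ ≤ 1 + ‖opU z c d‖ * ‖invU z c d‖ := by
    calc ‖invU z c d‖ = ‖1 - opU z c d * invU z c d‖ := by rw [← h1]
      _ ≤ ‖(1 : EllTwo →L[ℂ] EllTwo)‖ + ‖opU z c d * invU z c d‖ := norm_sub_le _ _
      _ ≤ _ := by
        rw [norm_one]
        gcongr
        exact norm_mul_le _ _
  nlinarith [norm_nonneg (invU z c d)]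

/-- The diagonal blocks `g_n` of the Green's function satisfy `T_n g_n = g_{n+1} T_{n+1}`. -/
theorem green_diag_succ (hz : 1 < ‖z‖) (hU : ‖opU z c d‖ < 1) (n : ℤ) :
    z * entry (green11 z c d) n n + c n * entry (green21 z c d) n n =
        z * entry (green11 z c d) (n + 1) (n + 1) +
          entry (green12 z c d) (n + 1) (n + 1) * d (n + 1) ∧
      z * entry (green12 z c d) n n + c n * entry (green22 z c d) n n =
        entry (green11 z c d) (n + 1) (n + 1) * c (n + 1) +
          z⁻¹ * entry (green12 z c d) (n + 1) (n + 1) ∧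
      d n * entry (green11 z c d) n n + z⁻¹ * entry (green21 z c d) n n =
        z * entry (green21 z c d) (n + 1) (n + 1) +
          entry (green22 z c d) (n + 1) (n + 1) * d (n + 1) ∧
      d n * entry (green12 z c d) n n + z⁻¹ * entry (green22 z c d) n n =
        entry (green21 z c d) (n + 1) (n + 1) * c (n + 1) +
          z⁻¹ * entry (green22 z c d) (n + 1) (n + 1) := by
  obtain ⟨⟨l1, l2, l3, l4⟩, r1, r2, r3, r4⟩ := green_identities (sub_mul_resP hz) (resP_mul_sub hz)
    (sub_mul_resM hz) (resM_mul_sub hz) (mul_invU_cancel hU) (invU_mul_cancel hU)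
  change _ * green11 z c d + mulOp c * green21 z c d = 1 at l1
  change mulOp d * green11 z c d - _ * green21 z c d = 0 at l2
  change _ * green12 z c d + mulOp c * green22 z c d = 0 at l3
  change mulOp d * green12 z c d - _ * green22 z c d = 1 at l4
  change green11 z c d * _ + green12 z c d * mulOp d = 1 at r1
  change green11 z c d * mulOp c - green12 z c d * _ = 0 at r2
  change green21 z c d * _ + green22 z c d * mulOp d = 0 at r3
  change green21 z c d * mulOp c - green22 z c d * _ = 1 at r4
  have e0 : ∀ n m, entry 0 n m = 0 := fun n m => rfl
  simp only [sub_mul, mul_sub, smul_mul_assoc, mul_smul_comm, one_mul, mul_one]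
    at l1 l2 l3 l4 r1 r2 r3 r4
  -- The left identities are read at (n, n) and the right ones at (n+1, n+1). In both, the shift
  -- produces the off-diagonal entry (n+1, n), so it cancels when the two are subtracted.
  have l1' := congrArg (fun A => entry A n n) l1
  have l2' := congrArg (fun A => entry A n n) l2
  have l3' := congrArg (fun A => entry A n n) l3
  have l4' := congrArg (fun A => entry A n n) l4
  have r1' := congrArg (fun A => entry A (n + 1) (n + 1)) r1
  have r2' := congrArg (fun A => entry A (n + 1) (n + 1)) r2
  have r3' := congrArg (fun A => entry A (n + 1) (n + 1)) r3
  have r4' := congrArg (fun A => entry A (n + 1) (n + 1)) r4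
  simp only [entry_add, entry_sub, entry_smul, entry_mulOp_mul, entry_mul_mulOp, entry_shift_mul,
    entry_mul_shift, entry_one, if_pos, e0, add_sub_cancel_right] at l1' l2' l3' l4' r1' r2' r3' r4'
  refine ⟨?_, ?_, ?_, ?_⟩
  · linear_combination l1' - r1'
  · linear_combination l3' - r2'
  · linear_combination l2' - r3'
  · linear_combination l4' - r4'

/-! Values outside the support of the coefficients. -/

theorem resP_mulOp_apply_eq_zero (hz : 1 < ‖z‖) {n : ℤ} (hd : ∀ m < n, d m = 0) (f : EllTwo) :
    (resP z * mulOp d) f n = 0 := by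
  have h := hasSum_entry (resP z * mulOp d) f n
  refine h.unique (hasSum_of_eq hasSum_zero fun m => ?_)
  rw [entry_mul_mulOp, entry_resP hz, kerP]
  split_ifs with h1
  · rw [hd m (by omega)]
    simp
  · simp

theorem resM_mulOp_apply_eq_zero (hz : 1 < ‖z‖) {n : ℤ} (hc : ∀ m, n ≤ m → c m = 0) (f : EllTwo) :
    (resM z * mulOp c) f n = 0 := by
  have h := hasSum_entry (resM z * mulOp c) f n
  refine h.unique (hasSum_of_eq hasSum_zero fun m => ?_)
  rw [entry_mul_mulOp, entry_resM hz, kerM]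
  split_ifs with h1
  · rw [hc m (by omega)]
    simp
  · simp

theorem mulOp_resP_single_eq_zero (hz : 1 < ‖z‖) {n : ℤ} (hc : ∀ m, n < m → c m = 0) :
    (mulOp c * resP z) (lp.single 2 n 1) = 0 := by
  ext m
  change entry (mulOp c * resP z) m n = 0
  rw [entry_mulOp_mul, entry_resP hz, kerP]
  split_ifs with h1
  · rw [hc m (by omega)]
    simp
  · simp

theorem mulOp_resM_single_eq_zero (hz : 1 < ‖z‖) {n : ℤ} (hd : ∀ m ≤ n, d m = 0) :
    (mulOp d * resM z) (lp.single 2 n 1) = 0 := by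
  ext m
  change entry (mulOp d * resM z) m n = 0
  rw [entry_mulOp_mul, entry_resM hz, kerM]
  split_ifs with h1
  · rw [hd m (by omega)]
    simp
  · simp

/-- Every correction to the free resolvents in these three entries passes, by one-sidedness of the
kernels, through a site m ≥ n, where `c` vanishes. The (2,1) entry is not determined this way.
`green_diag_left` is the mirror image, with `d` in place of `c`, and leaves the (1,2) entry
undetermined. -/
theorem green_diag_right (hz : 1 < ‖z‖) (hU : ‖opU z c d‖ < 1) {n : ℤ}
    (hc : ∀ m, n ≤ m → c m = 0) :
    entry (green11 z c d) n n = z⁻¹ ∧ entry (green12 z c d) n n = 0 ∧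
      entry (green22 z c d) n n = 0 := by
  have h0 := mulOp_resP_single_eq_zero (c := c) hz (n := n) fun m hm => hc m hm.le
  refine ⟨?_, ?_, ?_⟩
  · have h1 : green11 z c d = resM z -
        resM z * mulOp c * (resP z * (mulOp d * resM z) * invU z c d) := by
      have h2 := congrArg (resM z * ·) (mul_invU_cancel hU)
      simp only [mul_one] at h2
      rw [eq_sub_iff_add_eq]
      refine Eq.trans ?_ h2
      rw [green11, opU]
      noncomm_ring
    have h3 : entry (resM z * mulOp c * (resP z * (mulOp d * resM z) * invU z c d)) n n = 0 :=
      resM_mulOp_apply_eq_zero hz hc ((resP z * (mulOp d * resM z) * invU z c d) (lp.single 2 n 1))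
    rw [h1, entry_sub, entry_resM hz, h3]
    simp [kerM]
  · have h1 : green12 z c d = resM z * invU z c d * (mulOp c * resP z) := by
      rw [green12, mul_assoc _ (mulOp c)]
    rw [h1, entry, mul_apply_eq_comp, h0, map_zero]
    rfl
  · have h1 : green22 z c d = resP z * mulOp d * resM z * invU z c d * (mulOp c * resP z) -
        resP z := by
      rw [green22, mul_assoc _ (mulOp c)]
    rw [h1, entry_sub, entry, mul_apply_eq_comp, h0, map_zero, entry_resP hz]
    simp [kerP]

theorem green_diag_left (hz : 1 < ‖z‖) (hU : ‖opU z c d‖ < 1) {n : ℤ}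
    (hd : ∀ m ≤ n, d m = 0) :
    entry (green11 z c d) n n = z⁻¹ ∧ entry (green21 z c d) n n = 0 ∧
      entry (green22 z c d) n n = 0 := by
  have h0 := mulOp_resM_single_eq_zero hz hd
  have hU0 : opU z c d (lp.single 2 n 1) = 0 := by
    rw [opU, mul_apply_eq_comp, h0, map_zero]
  have hD : invU z c d (lp.single 2 n 1) = lp.single 2 n 1 := by
    have h := congrArg (fun A : EllTwo →L[ℂ] EllTwo => A (lp.single 2 n 1)) (invU_mul_cancel hU)
    simpa [mul_add, hU0] using h
  refine ⟨?_, ?_, ?_⟩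
  · rw [green11, entry, mul_apply_eq_comp, hD]
    change entry (resM z) n n = _
    rw [entry_resM hz]
    simp [kerM]
  · have h1 : green21 z c d = resP z * (mulOp d * resM z) * invU z c d := by
      rw [green21, mul_assoc (resP z)]
    rw [h1, entry, mul_apply_eq_comp, hD, mul_apply_eq_comp, h0, map_zero]
    rfl
  · have h1 : green22 z c d = resP z * mulOp d * (resM z * invU z c d * mulOp c * resP z) -
        resP z := by
      rw [green22]
      noncomm_ring
    have h3 : entry (resP z * mulOp d * (resM z * invU z c d * mulOp c * resP z)) n n = 0 :=
      resP_mulOp_apply_eq_zero hz (fun m hm => hd m hm.le) ((resM z * invU z c d * mulOp c * resP z) (lp.single 2 n 1))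
    rw [h1, entry_sub, entry_resP hz, h3]
    simp [kerP]

end Green

/-! ### Conservation of the trace series -/

/-- The partial trace over `F`. -/
def partialTrace (F : Finset ℤ) : (EllTwo →L[ℂ] EllTwo) →L[ℂ] ℂ := ∑ n ∈ F, entryCLM n n

theorem partialTrace_apply (F : Finset ℤ) (A : EllTwo →L[ℂ] EllTwo) :
    partialTrace F A = ∑ n ∈ F, entry A n n := by
  simp [partialTrace]

theorem proj_single (F : Finset ℤ) {n : ℤ} (hn : n ∈ F) :
    proj F (lp.single 2 n 1) = (lp.single 2 n (1 : ℂ) : EllTwo) := by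
  ext m
  rw [proj_apply, single_one_apply]
  split_ifs with h1 h2 h2
  · rfl
  · rfl
  · exact absurd (h2 ▸ hn) h1
  · rfl

theorem proj_single_of_notMem (F : Finset ℤ) {n : ℤ} (hn : n ∉ F) :
    proj F (lp.single 2 n (1 : ℂ) : EllTwo) = 0 := by
  ext m
  rw [proj_apply, single_one_apply]
  split_ifs with h1 h2
  · exact absurd (h2 ▸ h1) hn
  · rfl
  · rfl

theorem entry_mul_proj (F : Finset ℤ) (A : EllTwo →L[ℂ] EllTwo) (n : ℤ) {m : ℤ} (hm : m ∈ F) :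
    entry (A * proj F) n m = entry A n m := by
  rw [entry, mul_apply_eq_comp, proj_single F hm]
  rfl

theorem entry_mul_proj_of_notMem (F : Finset ℤ) (A : EllTwo →L[ℂ] EllTwo) (n : ℤ) {m : ℤ}
    (hm : m ∉ F) : entry (A * proj F) n m = 0 := by
  rw [entry, mul_apply_eq_comp, proj_single_of_notMem F hm, map_zero]
  rfl

theorem partialTrace_mul_proj (F : Finset ℤ) (A : EllTwo →L[ℂ] EllTwo) :
    partialTrace F (A * proj F) = partialTrace F A := by
  rw [partialTrace_apply, partialTrace_apply]
  exact Finset.sum_congr rfl fun n hn => entry_mul_proj F A n hn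

/-- When `A` lives on the block F × F, both sides are finite double sums and may be interchanged;
for general `A` a partial trace is not cyclic. -/
theorem partialTrace_mul_comm (F : Finset ℤ) {A : EllTwo →L[ℂ] EllTwo}
    (hrow : ∀ n ∉ F, ∀ m, entry A n m = 0) (hcol : ∀ n, ∀ m ∉ F, entry A n m = 0)
    (B : EllTwo →L[ℂ] EllTwo) : partialTrace F (A * B) = partialTrace F (B * A) := by
  have h1 : ∀ n, entry (A * B) n n = ∑ m ∈ F, entry A n m * entry B m n := fun n =>
    (hasSum_entry_mul A B n n).unique (hasSum_sum_of_ne_finset_zero fun m hm => by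
      rw [hcol n m hm, zero_mul])
  have h2 : ∀ n, entry (B * A) n n = ∑ m ∈ F, entry B n m * entry A m n := fun n =>
    (hasSum_entry_mul B A n n).unique (hasSum_sum_of_ne_finset_zero fun m hm => by
      rw [hrow m hm, mul_zero])
  simp only [partialTrace_apply, h1, h2]
  rw [Finset.sum_comm]
  exact Finset.sum_congr rfl fun n _ => Finset.sum_congr rfl fun m _ => mul_comm _ _

theorem mulOp_mul_proj {F : Finset ℤ} {c : EllTwo} (hc : ∀ n ∉ F, c n = 0) :
    proj F * mulOp c = mulOp c := by
  ext f n
  rw [mul_apply_eq_comp, proj_apply, mulOp_apply]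
  split_ifs with h
  · rfl
  · rw [hc n h, zero_mul]

theorem proj_mul_opU {F : Finset ℤ} {z : ℂ} {c d : EllTwo} (hc : ∀ n ∉ F, c n = 0) :
    proj F * opU z c d = opU z c d := by
  rw [opU, mul_assoc (mulOp c), ← mul_assoc, mulOp_mul_proj hc]

theorem opU_mul_proj_pow {F : Finset ℤ} {z : ℂ} {c d : EllTwo} (hc : ∀ n ∉ F, c n = 0) (k : ℕ) :
    (opU z c d * proj F) ^ (k + 1) = opU z c d ^ (k + 1) * proj F := by
  induction k with
  | zero => simp
  | succ k ih =>
    rw [pow_succ, ih, pow_succ _ (k + 1), mul_assoc, ← mul_assoc (proj F), proj_mul_opU hc,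
      mul_assoc]

/-- Replaces the trace over ℤ by the partial trace, a bounded functional on operators, and U by an
operator living on F × F; this is the form to which `hasDerivAt_log_series` applies. -/
theorem logTrace_eq_of_support {F : Finset ℤ} {z : ℂ} {c d : EllTwo} (hc : ∀ n ∉ F, c n = 0) :
    logTrace z c d = ∑' k : ℕ, (-1) ^ (k + 2) / ((k : ℂ) + 1) *
      partialTrace F ((opU z c d * proj F) ^ (k + 1)) := by
  refine tsum_congr fun k => ?_
  rw [opU_mul_proj_pow hc, partialTrace_mul_proj, partialTrace_apply]
  congr 1
  refine tsum_eq_sum fun n hn => ?_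
  rw [pow_succ', opU, mul_assoc, mul_assoc, entry_mulOp_mul, hc n hn, zero_mul]

/-- Writing Q for the projection, QU = U gives the intertwining Q(1 + UQ) = (1 + U)Q, which is then
inverted on both sides. -/
theorem proj_mul_inverse {F : Finset ℤ} {z : ℂ} {c d : EllTwo} (hc : ∀ n ∉ F, c n = 0)
    (hU : ‖opU z c d‖ < 1) :
    proj F * Ring.inverse (1 + opU z c d * proj F) = invU z c d * proj F := by
  have hlt : ‖opU z c d * proj F‖ < 1 := by
    refine lt_of_le_of_lt ?_ hU
    refine (norm_mul_le _ _).trans ?_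
    nlinarith [norm_proj_le F, norm_nonneg (opU z c d)]
  have h1 := Ring.mul_inverse_cancel _ (isUnit_one_add hlt)
  have h2 : proj F * (1 + opU z c d * proj F) = (1 + opU z c d) * proj F := by
    rw [mul_add, ← mul_assoc, proj_mul_opU hc]
    noncomm_ring
  calc _ = invU z c d * ((1 + opU z c d) * proj F) * Ring.inverse (1 + opU z c d * proj F) := by
        rw [← mul_assoc, invU_mul_cancel hU, one_mul]
    _ = invU z c d * proj F * ((1 + opU z c d * proj F) *
        Ring.inverse (1 + opU z c d * proj F)) := by rw [← h2, mul_assoc, mul_assoc, mul_assoc]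
    _ = _ := by rw [h1, mul_one]

/-- The derivative of the trace series in terms of the diagonal of the Green's function. -/
theorem partialTrace_inverse_mul {F : Finset ℤ} {z : ℂ} {c d c' d' : EllTwo}
    (hc : ∀ n ∉ F, c n = 0) (hc' : ∀ n ∉ F, c' n = 0)
    (hd' : ∀ n ∉ F, d' n = 0) (hU : ‖opU z c d‖ < 1) :
    partialTrace F (Ring.inverse (1 + opU z c d * proj F) *
        ((opU z c' d + opU z c d') * proj F)) =
      ∑ n ∈ F, (c' n * entry (green21 z c d) n n + d' n * entry (green12 z c d) n n) := by
  have hE := proj_mul_inverse hc hU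
  set E := Ring.inverse (1 + opU z c d * proj F)
  have hsupp : ∀ (x : EllTwo) (A : EllTwo →L[ℂ] EllTwo), (∀ n ∉ F, x n = 0) →
      ∀ B, partialTrace F (mulOp x * A * proj F * B) = partialTrace F (B * (mulOp x * A * proj F)) :=
    fun x A hx B => partialTrace_mul_comm F
      (fun n hn m => by rw [mul_assoc, entry_mulOp_mul, hx n hn, zero_mul])
      (fun n m hm => entry_mul_proj_of_notMem F _ n hm) B
  have h1 : partialTrace F (E * (opU z c' d * proj F)) =
      ∑ n ∈ F, c' n * entry (green21 z c d) n n := by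
    have e1 : opU z c' d * proj F = mulOp c' * (resP z * (mulOp d * resM z)) * proj F := by
      rw [opU, mul_assoc (mulOp c')]
    -- Cyclicity brings the factor living on F × F to the front, so that its trailing projection
    -- meets `E` and `hE` replaces the compressed inverse by `invU`.
    rw [e1, ← hsupp c' _ hc', mul_assoc, hE, ← mul_assoc, partialTrace_mul_proj, partialTrace_apply]
    refine Finset.sum_congr rfl fun n _ => ?_
    rw [mul_assoc, entry_mulOp_mul, green21]
    simp only [mul_assoc]
  have h2 : partialTrace F (E * (opU z c d' * proj F)) =
      ∑ n ∈ F, d' n * entry (green12 z c d) n n := by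
    have e1 : E * (opU z c d' * proj F) = E * (mulOp c * resP z) * (mulOp d' * resM z * proj F) := by
      rw [opU]
      noncomm_ring
    have e2 : mulOp d' * resM z * proj F * (E * (mulOp c * resP z)) =
        mulOp d' * green12 z c d := by
      calc _ = mulOp d' * resM z * (proj F * E) * (mulOp c * resP z) := by noncomm_ring
        _ = mulOp d' * resM z * invU z c d * (proj F * mulOp c) * resP z := by
          rw [hE]
          noncomm_ring
        _ = _ := by
          rw [mulOp_mul_proj hc, green12]
          noncomm_ring
    rw [e1, ← hsupp d' _ hd', e2, partialTrace_apply]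
    rfl
  rw [add_mul, mul_add, map_add, h1, h2, Finset.sum_add_distrib]

/-! ### The flow -/

/-- The time derivative of `α_n` along the flow. -/
def velocity (s : ℝ) (a : EllTwo) (n : ℤ) : ℂ := -Complex.I * rhs s a n

/-- The time derivative of `β_n` along the flow. -/
def betaVelocity (s : ℝ) (a : EllTwo) (n : ℤ) : ℂ := s * conj (velocity s a n)

section Flow

variable {s : ℝ} {α : ℝ → EllTwo}

theorem IsSolution.hasDerivAt (hα : IsSolution s α) (n : ℤ) (t : ℝ) :
    HasDerivAt (fun τ => α τ n) (velocity s (α t) n) t := by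
  obtain ⟨v, hv, h⟩ := hα.equation t n
  have : velocity s (α t) n = v := by
    rw [velocity, ← h, ← mul_assoc]
    simp
  rwa [this]

theorem IsSolution.hasDerivAt_beta (hα : IsSolution s α) (n : ℤ) (t : ℝ) :
    HasDerivAt (fun τ => beta s (α τ) n) (betaVelocity s (α t) n) t :=
  ((hα.hasDerivAt n t).star).const_mul (s : ℂ)

theorem IsSolution.continuous_apply (hα : IsSolution s α) (n : ℤ) :
    Continuous fun t => α t n :=
  (coord n).continuous.comp hα.continuous

theorem IsSolution.continuous_beta_apply (hα : IsSolution s α) (n : ℤ) :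
    Continuous fun t => beta s (α t) n :=
  (Complex.continuous_conj.comp (hα.continuous_apply n)).const_smul (s : ℂ)

theorem IsSolution.continuous_velocity (hα : IsSolution s α) (n : ℤ) :
    Continuous fun t => velocity s (α t) n := by
  have h := hα.continuous_apply
  have h' := hα.continuous_beta_apply
  unfold velocity rhs
  fun_prop

theorem IsSolution.continuous_betaVelocity (hα : IsSolution s α) (n : ℤ) :
    Continuous fun t => betaVelocity s (α t) n :=
  (Complex.continuous_conj.comp (hα.continuous_velocity n)).const_smul (s : ℂ)

theorem I_mul_velocity (s : ℝ) (a : EllTwo) (n : ℤ) : Complex.I * velocity s a n =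
    -(a (n - 1) - 2 * a n + a (n + 1)) + a n * beta s a n * (a (n - 1) + a (n + 1)) := by
  rw [velocity, ← mul_assoc]
  simp [rhs]

theorem I_mul_betaVelocity (s : ℝ) (a : EllTwo) (n : ℤ) : Complex.I * betaVelocity s a n =
    (beta s a (n - 1) - 2 * beta s a n + beta s a (n + 1)) -
      a n * beta s a n * (beta s a (n - 1) + beta s a (n + 1)) := by
  simp only [betaVelocity, velocity, rhs, beta_apply, map_add, map_sub, map_mul, map_neg,
    Complex.conj_I, Complex.conj_conj, Complex.conj_ofReal, map_ofNat]
  linear_combination (s : ℂ) * (-(conj (a (n - 1)) - 2 * conj (a n) + conj (a (n + 1))) +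
    conj (a n) * (s * a n) * (conj (a (n - 1)) + conj (a (n + 1)))) * Complex.I_mul_I

/-- Compact subsets of `ℓ²` have uniformly small coordinates near infinity. -/
theorem eventually_forall_norm_apply_lt {S : Set EllTwo} (hS : IsCompact S) {ε : ℝ} (hε : 0 < ε) :
    ∀ᶠ n in Filter.cofinite, ∀ x ∈ S, ‖x n‖ < ε := by
  refine hS.induction_on (p := fun S => ∀ᶠ n in Filter.cofinite, ∀ x ∈ S, ‖x n‖ < ε) (by simp)
    (fun S T hST h => h.mono fun n hn x hx => hn x (hST hx))
    (fun S T h1 h2 => by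
      filter_upwards [h1, h2] with n hn1 hn2 x hx
      exact hx.elim (hn1 x) (hn2 x)) fun x _ => ?_
  refine ⟨Metric.ball x (ε / 2), mem_nhdsWithin_of_mem_nhds (Metric.ball_mem_nhds x (half_pos hε)),
    ?_⟩
  have h0 := (hasSum_norm_sq x).summable.tendsto_cofinite_zero
  filter_upwards [h0.eventually_lt_const (show (0 : ℝ) < (ε / 2) ^ 2 by positivity)] with n hn y hy
  have h1 : ‖x n‖ < ε / 2 := lt_of_pow_lt_pow_left₀ 2 (by positivity) hn
  have h2 : ‖(y - x) n‖ < ε / 2 :=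
    (norm_apply_le _ n).trans_lt (by rwa [Metric.mem_ball, dist_eq_norm] at hy)
  have h3 : y n = (y - x) n + x n := by simp
  rw [h3]
  exact (norm_add_le _ _).trans_lt (by linarith)

/-- A limit of functions whose derivatives are controlled by the coordinates of a continuous curve
near infinity is constant. -/
theorem eq_of_hasDerivAt_boundary (hα : Continuous α) {E : Type*} [NormedAddCommGroup E]
    [NormedSpace ℝ E] {f : ℝ → E} {fK fK' : ℕ → ℝ → E}
    (hder : ∀ K t, HasDerivAt (fK K) (fK' K t) t)
    (hlim : ∀ t, Filter.Tendsto (fun K => fK K t) Filter.atTop (nhds (f t)))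
    (hbound : ∀ T : ℝ, ∃ C : ℝ, ∀ (K : ℕ) (t : ℝ), |t| ≤ T → ‖fK' K t‖ ≤
      C * (‖α t (K + 1)‖ + ‖α t K‖ + ‖α t (-K)‖ + ‖α t (-K - 1)‖)) (t : ℝ) : f t = f 0 := by
  obtain ⟨C, hC⟩ := hbound |t|
  have hS : IsCompact (α '' Set.Icc (-|t|) |t|) := isCompact_Icc.image hα
  -- For K large the four edge coordinates are below ε on the whole time interval, so the mean value
  -- inequality applies to `fK K`; the bound survives K → ∞, and then ε → 0.
  have key : ∀ ε : ℝ, 0 < ε → ‖f t - f 0‖ ≤ |C| * (4 * ε) * |t| := fun ε hε => by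
    have h1 := eventually_forall_norm_apply_lt hS hε
    have hinj : ∀ g : ℕ → ℤ, Function.Injective g →
        ∀ᶠ K in Filter.atTop, ∀ x ∈ α '' Set.Icc (-|t|) |t|, ‖x (g K)‖ < ε := fun g hg => by
      rw [← Nat.cofinite_eq_atTop]
      exact hg.tendsto_cofinite.eventually h1
    have e1 := hinj (fun K => (K : ℤ) + 1) fun a b h => by simpa using h
    have e2 := hinj (fun K => (K : ℤ)) fun a b h => by simpa using h
    have e3 := hinj (fun K => -(K : ℤ)) fun a b h => by simpa using h
    have e4 := hinj (fun K => -(K : ℤ) - 1) fun a b h => by simpa using h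
    refine le_of_tendsto (((hlim t).sub (hlim 0)).norm) ?_
    filter_upwards [e1, e2, e3, e4] with K h1 h2 h3 h4
    have hb : ∀ x ∈ Set.Icc (-|t|) |t|, ‖fK' K x‖ ≤ |C| * (4 * ε) := fun x hx => by
      have hx' : α x ∈ α '' Set.Icc (-|t|) |t| := ⟨x, hx, rfl⟩
      refine (hC K x (abs_le.mpr hx)).trans ?_
      refine mul_le_mul (le_abs_self C) ?_ (by positivity) (abs_nonneg C)
      linarith [h1 _ hx', h2 _ hx', h3 _ hx', h4 _ hx']
    have := Convex.norm_image_sub_le_of_norm_hasDerivWithin_le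
      (fun x _ => (hder K x).hasDerivWithinAt) hb (convex_Icc _ _)
      (show (0 : ℝ) ∈ Set.Icc (-|t|) |t| from ⟨by simp, by simp⟩)
      (show t ∈ Set.Icc (-|t|) |t| from ⟨neg_abs_le t, le_abs_self t⟩)
    simpa using this
  have h0 : ‖f t - f 0‖ ≤ 0 := by
    have hT : Filter.Tendsto (fun ε : ℝ => |C| * (4 * ε) * |t|) (nhdsWithin 0 (Set.Ioi 0))
        (nhds (|C| * (4 * 0) * |t|)) := by
      refine Filter.Tendsto.mono_left ?_ nhdsWithin_le_nhds
      exact Continuous.tendsto (f := fun ε : ℝ => |C| * (4 * ε) * |t|) (by fun_prop) 0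
    rw [mul_zero, mul_zero, zero_mul] at hT
    refine ge_of_tendsto hT ?_
    filter_upwards [self_mem_nhdsWithin] with ε hε using key ε hε
  exact sub_eq_zero.mp (norm_le_zero_iff.mp h0)

end Flow

/-! ### The local conservation law: flux and boundary terms. -/

theorem sum_Icc_neg_telescope {E : Type*} [AddCommGroup E] (φ : ℤ → E) (K : ℕ) :
    ∑ n ∈ Finset.Icc (-(K : ℤ)) K, (φ (n + 1) - φ n) = φ (K + 1) - φ (-K) := by
  induction K with
  | zero => simp
  | succ K ih =>
    have h : Finset.Icc (-((K + 1 : ℕ) : ℤ)) ((K + 1 : ℕ) : ℤ) =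
        insert ((K : ℤ) + 1) (insert (-(K : ℤ) - 1) (Finset.Icc (-(K : ℤ)) K)) := by
      ext n
      simp only [Finset.mem_Icc, Finset.mem_insert]
      omega
    rw [h, Finset.sum_insert, Finset.sum_insert, ih]
    · push_cast
      rw [show -(K : ℤ) - 1 + 1 = -K by ring, show -((K : ℤ) + 1) = -K - 1 by ring]
      abel
    · simp
    · simp only [Finset.mem_insert, Finset.mem_Icc]
      omega

/-- The flux `tr (W_n V_n)`, where `W_n = g_n T_n` and `V_n` is the Lax matrix of the flow. -/
def flux (z : ℂ) (a b : ℤ → ℂ) (c d : EllTwo) (n : ℤ) : ℂ :=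
  (z * entry (green11 z c d) n n + entry (green12 z c d) n n * d n) *
      (a n * b (n - 1) + (2 - z ^ 2 - z⁻¹ ^ 2)) +
    (entry (green11 z c d) n n * c n + z⁻¹ * entry (green12 z c d) n n) *
      (z⁻¹ * b n - z * b (n - 1)) +
    (z * entry (green21 z c d) n n + entry (green22 z c d) n n * d n) *
      (-z * a n + z⁻¹ * a (n - 1)) +
    (entry (green21 z c d) n n * c n + z⁻¹ * entry (green22 z c d) n n) *
      (-a (n - 1) * b n)

section

variable {z : ℂ}

theorem ne_zero_of_one_lt_norm (hz : 1 < ‖z‖) : z ≠ 0 := by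
  rintro rfl
  rw [norm_zero] at hz
  linarith

/-- With T_n = [[z, c_n], [d_n, z⁻¹]], the relation g_{n+1} T_{n+1} = T_n g_n turns the difference
into tr(g_n (V_{n+1} T_n - T_n V_n)), and the zero-curvature equation identifies the bracket with i
∂ₜT_n. Only site `n` of `c`, `d` has to agree with `a`, `b`; the neighbours inside V are those of
the full sequences. This is why truncation costs nothing in the interior. -/
theorem flux_succ_sub (hz : 1 < ‖z‖) {c d : EllTwo} (hU : ‖opU z c d‖ < 1) {a b : ℤ → ℂ} {n : ℤ}
    (hc : c n = a n) (hd : d n = b n) :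
    flux z a b c d (n + 1) - flux z a b c d n =
      (-(a (n - 1) - 2 * a n + a (n + 1)) + a n * b n * (a (n - 1) + a (n + 1))) *
          entry (green21 z c d) n n +
        ((b (n - 1) - 2 * b n + b (n + 1)) - a n * b n * (b (n - 1) + b (n + 1))) *
          entry (green12 z c d) n n := by
  obtain ⟨h1, h2, h3, h4⟩ := green_diag_succ hz hU n
  have hw : z * z⁻¹ = 1 := mul_inv_cancel₀ (ne_zero_of_one_lt_norm hz)
  rw [flux, flux, ← h1, ← h2, ← h3, ← h4, add_sub_cancel_right, hc, hd]
  generalize entry (green11 z c d) n n = g11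
  generalize entry (green12 z c d) n n = g12
  generalize entry (green21 z c d) n n = g21
  generalize entry (green22 z c d) n n = g22
  generalize z⁻¹ = w at hw
  generalize a (n - 1) = am
  generalize a (n + 1) = ap
  generalize b (n - 1) = bm
  generalize b (n + 1) = bp
  generalize a n = a0
  generalize b n = b0
  linear_combination (g12 * (bp + bm) - g21 * (ap + am)) * hw

/-- Outside [-K, K] the Green's matrix is explicit except for one off-diagonal entry at each end.
That entry is bounded by operator norms, and it is multiplied by values of `a` or `b` at the edge.
-/
theorem norm_boundary_le (hz : 1 < ‖z‖) {c d : EllTwo} (hU : ‖opU z c d‖ ≤ 1 / 2)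
    (hc1 : ‖c‖ ≤ 1) (hd1 : ‖d‖ ≤ 1) {a b : ℤ → ℂ} (ha : ∀ n, ‖a n‖ ≤ 1) (hb : ∀ n, ‖b n‖ ≤ 1)
    {K : ℕ} (hc : ∀ n ∉ Finset.Icc (-(K : ℤ)) K, c n = 0)
    (hd : ∀ n ∉ Finset.Icc (-(K : ℤ)) K, d n = 0) :
    ‖flux z a b c d (K + 1) - flux z a b c d (-K)‖ ≤
      (1 + 4 * ‖z‖ ^ 2 * ‖resP z‖ * ‖resM z‖) *
        (‖a (K + 1)‖ + ‖a K‖ + ‖b (-K)‖ + ‖b (-K - 1)‖) := by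
  have hU1 : ‖opU z c d‖ < 1 := hU.trans_lt (by norm_num)
  have hw : z * z⁻¹ = 1 := mul_inv_cancel₀ (ne_zero_of_one_lt_norm hz)
  have hw1 : ‖z⁻¹‖ ≤ ‖z‖ := (norm_inv_lt_one hz).le.trans hz.le
  have hcK : ∀ n : ℤ, (K : ℤ) + 1 ≤ n → c n = 0 := fun n hn => hc n (by
    rw [Finset.mem_Icc]; omega)
  have hcK' : c (-(K : ℤ) - 1) = 0 := hc _ (by rw [Finset.mem_Icc]; omega)
  have hdK : ∀ n : ℤ, n ≤ -(K : ℤ) - 1 → d n = 0 := fun n hn => hd n (by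
    rw [Finset.mem_Icc]; omega)
  have hdK' : d ((K : ℤ) + 1) = 0 := hd _ (by rw [Finset.mem_Icc]; omega)
  obtain ⟨r1, r2, r3⟩ := green_diag_right hz hU1 hcK
  obtain ⟨l1, l2, l3⟩ := green_diag_left hz hU1 hdK
  obtain ⟨h1, h2, h3, h4⟩ := green_diag_succ hz hU1 (-(K : ℤ) - 1)
  have hmul : ∀ c : EllTwo, ‖mulOp c‖ ≤ ‖c‖ := fun c => by
    have h := mulOpCLM.le_opNorm c
    have h' : ‖mulOpCLM‖ ≤ 1 := LinearMap.mkContinuous_norm_le _ zero_le_one _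
    rw [mulOpCLM_apply] at h
    nlinarith [norm_nonneg c]
  have hD := norm_invU_le hU
  have hg21 : ‖entry (green21 z c d) (K + 1) (K + 1)‖ ≤ 2 * (‖resP z‖ * ‖resM z‖) := by
    refine (norm_entry_le _ _ _).trans ?_
    calc ‖green21 z c d‖ ≤ ‖resP z‖ * ‖mulOp d‖ * ‖resM z‖ * ‖invU z c d‖ := by
          refine (norm_mul_le _ _).trans ?_
          gcongr
          refine (norm_mul_le _ _).trans ?_
          gcongr
          exact norm_mul_le _ _
      _ ≤ ‖resP z‖ * 1 * ‖resM z‖ * 2 := by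
          gcongr
          exact (hmul d).trans hd1
      _ = _ := by ring
  have hg12 : ‖entry (green12 z c d) (-K - 1) (-K - 1)‖ ≤ 2 * (‖resP z‖ * ‖resM z‖) := by
    refine (norm_entry_le _ _ _).trans ?_
    calc ‖green12 z c d‖ ≤ ‖resM z‖ * ‖invU z c d‖ * ‖mulOp c‖ * ‖resP z‖ := by
          refine (norm_mul_le _ _).trans ?_
          gcongr
          refine (norm_mul_le _ _).trans ?_
          gcongr
          exact norm_mul_le _ _
      _ ≤ ‖resM z‖ * 2 * 1 * ‖resP z‖ := by
          gcongr
          exact (hmul c).trans hc1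
      _ = _ := by ring
  -- The left flux is rewritten through T_{-K-1} g_{-K-1}. At both ends the (1,1) entry of W equals
  -- z z⁻¹ = 1, so the scalars 2 - z² - z⁻² cancel and every remaining term contains an edge
  -- coordinate.
  have key : flux z a b c d (K + 1) - flux z a b c d (-K) =
      (a (K + 1) * b K - a (-K) * b (-K - 1)) +
        z * entry (green21 z c d) (K + 1) (K + 1) * (-z * a (K + 1) + z⁻¹ * a K) -
        z * entry (green12 z c d) (-K - 1) (-K - 1) * (z⁻¹ * b (-K) - z * b (-K - 1)) := by
    rw [sub_add_cancel] at h1 h2 h3 h4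
    rw [flux, flux, ← h1, ← h2, ← h3, ← h4, r1, r2, r3, l1, l2, l3, hcK _ le_rfl, hcK', hdK',
      hdK _ le_rfl, add_sub_cancel_right, hw]
    ring
  rw [key]
  generalize entry (green21 z c d) (K + 1) (K + 1) = g21 at hg21
  generalize entry (green12 z c d) (-K - 1) (-K - 1) = g12 at hg12
  set B := ‖resP z‖ * ‖resM z‖ with hB
  have hB0 : 0 ≤ B := by positivity
  have t1 : ‖a (K + 1) * b K - a (-K) * b (-K - 1)‖ ≤ ‖a (K + 1)‖ + ‖b (-K - 1)‖ := by
    refine (norm_sub_le _ _).trans ?_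
    rw [norm_mul, norm_mul]
    nlinarith [ha (-K), hb K, norm_nonneg (a (K + 1)), norm_nonneg (b (-K - 1))]
  have t2 : ‖z * g21 * (-z * a (K + 1) + z⁻¹ * a K)‖ ≤
      ‖z‖ * (2 * B) * (‖z‖ * ‖a (K + 1)‖ + ‖z‖ * ‖a K‖) := by
    rw [norm_mul, norm_mul]
    gcongr
    refine (norm_add_le _ _).trans ?_
    rw [norm_mul, norm_mul, norm_neg]
    gcongr
  have t3 : ‖z * g12 * (z⁻¹ * b (-K) - z * b (-K - 1))‖ ≤
      ‖z‖ * (2 * B) * (‖z‖ * ‖b (-K)‖ + ‖z‖ * ‖b (-K - 1)‖) := by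
    rw [norm_mul, norm_mul]
    gcongr
    refine (norm_sub_le _ _).trans ?_
    rw [norm_mul, norm_mul]
    gcongr
  have hz2 : 0 ≤ ‖z‖ ^ 2 * B := by positivity
  calc _ ≤ ‖a (K + 1)‖ + ‖b (-K - 1)‖ + ‖z‖ * (2 * B) * (‖z‖ * ‖a (K + 1)‖ + ‖z‖ * ‖a K‖) +
        ‖z‖ * (2 * B) * (‖z‖ * ‖b (-K)‖ + ‖z‖ * ‖b (-K - 1)‖) := by
        refine (norm_sub_le _ _).trans (add_le_add ((norm_add_le _ _).trans (add_le_add t1 t2)) t3)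
    _ ≤ _ := by
        have e : 4 * ‖z‖ ^ 2 * ‖resP z‖ * ‖resM z‖ = 4 * (‖z‖ ^ 2 * B) := by rw [hB]; ring
        rw [e]
        have n1 := norm_nonneg (a (K + 1))
        have n2 := norm_nonneg (a K)
        have n3 := norm_nonneg (b (-K))
        have n4 := norm_nonneg (b (-K - 1))
        have m : 0 ≤ ‖z‖ ^ 2 * B * (‖a (K + 1)‖ + ‖a K‖ + ‖b (-K)‖ + ‖b (-K - 1)‖) := by
          positivity
        linarith

/-- The sequence that agrees with `v` on `F` and vanishes elsewhere. -/
def restrictSeq (F : Finset ℤ) (v : ℤ → ℂ) : EllTwo :=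
  ∑ n ∈ F, v n • (lp.single 2 n (1 : ℂ) : EllTwo)

theorem restrictSeq_apply (F : Finset ℤ) (v : ℤ → ℂ) (n : ℤ) :
    restrictSeq F v n = if n ∈ F then v n else 0 := by
  rw [restrictSeq, sum_apply]
  simp only [lp.coeFn_smul, Pi.smul_apply, single_one_apply, smul_eq_mul, mul_ite, mul_one,
    mul_zero]
  simp

theorem hasDerivAt_restrictSeq (F : Finset ℤ) {v v' : ℝ → ℤ → ℂ} {t : ℝ}
    (h : ∀ n, HasDerivAt (fun t => v t n) (v' t n) t) :
    HasDerivAt (fun t => restrictSeq F (v t)) (restrictSeq F (v' t)) t :=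
  HasDerivAt.fun_sum fun n _ => (h n).smul_const _

theorem continuous_restrictSeq (F : Finset ℤ) {v : ℝ → ℤ → ℂ}
    (h : ∀ n, Continuous fun t => v t n) : Continuous fun t => restrictSeq F (v t) :=
  continuous_finsetSum _ fun n _ => (h n).smul continuous_const

theorem continuous_opU {c d : ℝ → EllTwo} (hc : Continuous c) (hd : Continuous d) :
    Continuous fun t => opU z (c t) (d t) :=
  continuous_iff_continuousAt.mpr fun _ => tendsto_opU z hc.continuousAt hd.continuousAt

theorem hasDerivAt_opU {c d : ℝ → EllTwo} {c' d' : EllTwo} {t : ℝ} (hc : HasDerivAt c c' t)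
    (hd : HasDerivAt d d' t) :
    HasDerivAt (fun t => opU z (c t) (d t)) (opU z c' (d t) + opU z (c t) d') t := by
  have h1 : HasDerivAt (fun t => mulOp (c t)) (mulOp c') t :=
    (mulOpCLM.restrictScalars ℝ).hasFDerivAt.comp_hasDerivAt t hc
  have h2 : HasDerivAt (fun t => mulOp (d t)) (mulOp d') t :=
    (mulOpCLM.restrictScalars ℝ).hasFDerivAt.comp_hasDerivAt t hd
  exact (h1.mul_const (resP z)).mul (h2.mul_const (resM z))

end

/-- The functionals `A(z; α)` are conserved. -/
theorem genA_conserved {z : ℂ} (hz : 1 < ‖z‖) {s : ℝ} (hs : s = 1 ∨ s = -1) {α : ℝ → EllTwo}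
    (hα : IsSolution s α) (h1 : ∀ t, ‖α t‖ ≤ 1) (hq : ∀ t, ‖α t‖ ^ 2 * resConst z ≤ 1 / 2) (t : ℝ) :
    genA s z (α t) = genA s z (α 0) := by
  have hq' : ∀ t, ‖α t‖ * ‖beta s (α t)‖ * resConst z ≤ 1 / 2 := fun t => by
    rw [norm_beta hs, ← sq]
    exact hq t
  let F : ℕ → Finset ℤ := fun K => Finset.Icc (-(K : ℤ)) K
  let c : ℕ → ℝ → EllTwo := fun K t => proj (F K) (α t)
  let d : ℕ → ℝ → EllTwo := fun K t => proj (F K) (beta s (α t))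
  -- The truncations do not solve the flow: their velocities are those of the full solution,
  -- restricted to F.
  let c' : ℕ → ℝ → EllTwo := fun K t => restrictSeq (F K) (velocity s (α t))
  let d' : ℕ → ℝ → EllTwo := fun K t => restrictSeq (F K) (betaVelocity s (α t))
  have hc0 : ∀ K t, ∀ n ∉ F K, c K t n = 0 := fun K t n hn => by
    simp only [c, proj_apply, if_neg hn]
  have hd0 : ∀ K t, ∀ n ∉ F K, d K t n = 0 := fun K t n hn => by
    simp only [d, proj_apply, if_neg hn]
  have hc0' : ∀ K t, ∀ n ∉ F K, c' K t n = 0 := fun K t n hn => by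
    simp only [c', restrictSeq_apply, if_neg hn]
  have hd0' : ∀ K t, ∀ n ∉ F K, d' K t n = 0 := fun K t n hn => by
    simp only [d', restrictSeq_apply, if_neg hn]
  have hcn : ∀ K t, ‖c K t‖ ≤ ‖α t‖ := fun K t =>
    norm_le_of_forall_norm_le (norm_proj_apply_le _ _)
  have hdn : ∀ K t, ‖d K t‖ ≤ ‖α t‖ := fun K t =>
    (norm_le_of_forall_norm_le (norm_proj_apply_le _ _)).trans (norm_beta hs _).le
  have hU : ∀ K t, ‖opU z (c K t) (d K t)‖ ≤ 1 / 2 := fun K t => by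
    refine ((norm_opU_le hz _ _).trans ?_).trans (hq t)
    rw [sq]
    exact mul_le_mul_of_nonneg_right (mul_le_mul (hcn K t) (hdn K t) (norm_nonneg _)
      (norm_nonneg _)) (resConst_nonneg hz)
  have hcd : ∀ K t, HasDerivAt (c K) (c' K t) t := fun K t => by
    have e : c K = fun t => restrictSeq (F K) (α t) := funext fun t => proj_apply_eq_sum _ _
    rw [e]
    exact hasDerivAt_restrictSeq (F K) (v' := fun t => velocity s (α t)) fun n => hα.hasDerivAt n t
  have hdd : ∀ K t, HasDerivAt (d K) (d' K t) t := fun K t => by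
    have e : d K = fun t => restrictSeq (F K) (beta s (α t)) :=
      funext fun t => proj_apply_eq_sum _ _
    rw [e]
    exact hasDerivAt_restrictSeq (F K) (v' := fun t => betaVelocity s (α t))
      fun n => hα.hasDerivAt_beta n t
  have hcc : ∀ K, Continuous (c K) := fun K =>
    continuous_iff_continuousAt.mpr fun t => (hcd K t).continuousAt
  have hdc : ∀ K, Continuous (d K) := fun K =>
    continuous_iff_continuousAt.mpr fun t => (hdd K t).continuousAt
  have hcc' : ∀ K, Continuous (c' K) := fun K => continuous_restrictSeq _ hα.continuous_velocity
  have hdc' : ∀ K, Continuous (d' K) := fun K => continuous_restrictSeq _ hα.continuous_betaVelocity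
  have hder : ∀ K t, HasDerivAt (fun t => logTrace z (c K t) (d K t))
      (∑ n ∈ F K, (c' K t n * entry (green21 z (c K t) (d K t)) n n +
        d' K t n * entry (green12 z (c K t) (d K t)) n n)) t := fun K t => by
    rw [← partialTrace_inverse_mul (hc0 K t) (hc0' K t) (hd0' K t)
      ((hU K t).trans_lt (by norm_num))]
    simp only [fun t => logTrace_eq_of_support (z := z) (d := d K t) (hc0 K t)]
    refine hasDerivAt_log_series (partialTrace (F K)) (r := 1 / 2)
      (U := fun t => opU z (c K t) (d K t) * proj (F K))
      (U' := fun t => (opU z (c' K t) (d K t) + opU z (c K t) (d' K t)) * proj (F K))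
      (by norm_num) (fun t => (hasDerivAt_opU (hcd K t) (hdd K t)).mul_const _) (fun t => ?_)
      ?_ (fun t x => ?_) t
    · refine (norm_mul_le _ _).trans ?_
      nlinarith [norm_proj_le (F K), hU K t, norm_nonneg (opU z (c K t) (d K t))]
    · exact ((continuous_opU (hcc' K) (hdc K)).add (continuous_opU (hcc K) (hdc' K))).mul
        continuous_const
    · refine partialTrace_mul_comm (F K) (fun n hn m => ?_)
        (fun n m hm => entry_mul_proj_of_notMem _ _ n hm) x
      rw [opU, mul_assoc, mul_assoc, entry_mulOp_mul, hc0 K t n hn, zero_mul]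
  refine eq_of_hasDerivAt_boundary (f := fun t => genA s z (α t)) hα.continuous hder (fun t => ?_)
    (fun T =>
    ⟨1 + 4 * ‖z‖ ^ 2 * ‖resP z‖ * ‖resM z‖, fun K t _ => ?_⟩) t
  · exact tendsto_logTrace hz ((hq' t).trans_lt (by norm_num)) (tendsto_proj _) (tendsto_proj _)
      (fun K => norm_proj_apply_le _ _) (fun K => norm_proj_apply_le _ _)
  -- The factor i puts the velocities into the form occurring in `flux_succ_sub`; having modulus
  -- one, it does not affect the final bound.
  · have hsum : Complex.I * ∑ n ∈ F K, (c' K t n * entry (green21 z (c K t) (d K t)) n n +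
        d' K t n * entry (green12 z (c K t) (d K t)) n n) =
        flux z (α t) (beta s (α t)) (c K t) (d K t) (K + 1) -
          flux z (α t) (beta s (α t)) (c K t) (d K t) (-K) := by
      rw [← sum_Icc_neg_telescope, Finset.mul_sum]
      refine Finset.sum_congr rfl fun n hn => ?_
      replace hn : n ∈ F K := hn
      rw [flux_succ_sub hz ((hU K t).trans_lt (by norm_num))
        (show c K t n = α t n by simp only [c, proj_apply, if_pos hn])
        (show d K t n = beta s (α t) n by simp only [d, proj_apply, if_pos hn]),
        ← I_mul_velocity, ← I_mul_betaVelocity]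
      simp only [c', d', restrictSeq_apply, if_pos hn]
      ring
    have hb := norm_boundary_le hz (hU K t) ((hcn K t).trans (h1 t)) ((hdn K t).trans (h1 t))
      (a := α t) (b := beta s (α t)) (fun n => (norm_apply_le _ n).trans (h1 t))
      (fun n => (norm_beta_apply hs _ n).le.trans ((norm_apply_le _ n).trans (h1 t)))
      (hc0 K t) (hd0 K t)
    rw [← hsum, norm_mul, Complex.norm_I, one_mul, norm_beta_apply hs, norm_beta_apply hs] at hb
    exact hb

/-! ### Conservation of the mass -/

/-- The density `1 - α_n β_n`. -/
def density (s : ℝ) (a : EllTwo) (n : ℤ) : ℝ := 1 - (a n * beta s a n).re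

theorem re_mul_beta (s : ℝ) (a : EllTwo) (n : ℤ) : (a n * beta s a n).re = s * ‖a n‖ ^ 2 := by
  rw [beta_apply, mul_left_comm, Complex.mul_conj, ← Complex.ofReal_mul, Complex.ofReal_re,
    Complex.normSq_eq_norm_sq]

theorem density_eq (s : ℝ) (a : EllTwo) (n : ℤ) : density s a n = 1 - s * ‖a n‖ ^ 2 := by
  rw [density, re_mul_beta]

/-- The mass current `Im (conj α_n α_{n+1})`. -/
def current (a : EllTwo) (n : ℤ) : ℝ := (conj (a n) * a (n + 1)).im

section Flow

variable {s : ℝ} {α : ℝ → EllTwo}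

theorem IsSolution.continuous_current (hα : IsSolution s α) (n : ℤ) :
    Continuous fun t => current (α t) n := by
  have h := hα.continuous_apply
  unfold current
  fun_prop

/-- The right-hand side is 2α_n - (1 - α_nβ_n)(α_{n-1} + α_{n+1}). The first term only rotates the
phase, and the second carries the density as a factor. -/
theorem IsSolution.hasDerivAt_density (hα : IsSolution s α) (n : ℤ) (t : ℝ) :
    HasDerivAt (fun t => density s (α t) n)
      (density s (α t) n * (2 * s * (current (α t) n - current (α t) (n - 1)))) t := by
  have h1 := Complex.reCLM.hasFDerivAt.comp_hasDerivAt t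
    ((hα.hasDerivAt n t).mul (hα.hasDerivAt_beta n t))
  have h2 := h1.const_sub 1
  refine h2.congr_deriv ?_
  rw [density_eq]
  simp only [current, betaVelocity, velocity, rhs, beta_apply, sub_add_cancel]
  generalize α t (n - 1) = am
  generalize α t (n + 1) = ap
  generalize α t n = a
  rw [← Complex.normSq_eq_norm_sq, Complex.normSq_apply]
  simp
  ring

/-- The density solves a scalar linear equation, so an integrating factor shows that it keeps its
sign; this makes the logarithm differentiable along the flow. -/
theorem IsSolution.density_eq_mul_exp (hα : IsSolution s α) (n : ℤ) (t : ℝ) :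
    density s (α t) n = density s (α 0) n *
      Real.exp (∫ τ in (0 : ℝ)..t, 2 * s * (current (α τ) n - current (α τ) (n - 1))) := by
  set g : ℝ → ℝ := fun τ => 2 * s * (current (α τ) n - current (α τ) (n - 1)) with hg
  have hgc : Continuous g := ((hα.continuous_current n).sub
    (hα.continuous_current (n - 1))).const_smul (2 * s)
  have hI : ∀ t, HasDerivAt (fun t => ∫ τ in (0 : ℝ)..t, g τ) (g t) t := fun t =>
    intervalIntegral.integral_hasDerivAt_right (hgc.intervalIntegrable _ _)
      (hgc.stronglyMeasurableAtFilter _ _) hgc.continuousAt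
  have hd : ∀ t, HasDerivAt
      (fun t => density s (α t) n * Real.exp (-∫ τ in (0 : ℝ)..t, g τ)) 0 t := fun t => by
    refine ((hα.hasDerivAt_density n t).mul (hI t).neg.exp).congr_deriv ?_
    simp only [hg]
    ring
  have hconst := is_const_of_deriv_eq_zero (fun t => (hd t).differentiableAt)
    (fun t => (hd t).deriv) t 0
  simp only [intervalIntegral.integral_same, neg_zero, Real.exp_zero, mul_one] at hconst
  rw [← hconst, mul_assoc, ← Real.exp_add, neg_add_cancel, Real.exp_zero, mul_one]

theorem IsSolution.density_pos (hα : IsSolution s α) (h0 : ∀ n, 0 < density s (α 0) n) (n : ℤ)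
    (t : ℝ) : 0 < density s (α t) n := by
  rw [hα.density_eq_mul_exp]
  exact mul_pos (h0 n) (Real.exp_pos _)

theorem summable_log_density (s : ℝ) (a : EllTwo) :
    Summable fun n => Real.log (density s a n) := by
  have h : Summable fun n => -(s * ‖a n‖ ^ 2) :=
    ((hasSum_norm_sq a).summable.mul_left s).neg
  have h2 := Real.summable_log_one_add_of_summable h
  refine h2.congr fun n => ?_
  rw [density_eq, sub_eq_add_neg]

theorem IsSolution.mass_conserved (hα : IsSolution s α) (h0 : ∀ n, 0 < density s (α 0) n) (t : ℝ) :
    mass s (α t) = mass s (α 0) := by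
  refine eq_of_hasDerivAt_boundary (f := fun t => mass s (α t)) hα.continuous
    (fK := fun K t => -∑ n ∈ Finset.Icc (-(K : ℤ)) K, Real.log (density s (α t) n))
    (fK' := fun K t => -(2 * s * (current (α t) K - current (α t) (-K - 1))))
    (fun K t => ?_) (fun t => ?_) (fun T => ?_) t
  · have h1 : HasDerivAt (fun t => ∑ n ∈ Finset.Icc (-(K : ℤ)) K, Real.log (density s (α t) n))
        (∑ n ∈ Finset.Icc (-(K : ℤ)) K,
          -- Left unsimplified, to match φ(n+1) - φ(n) with φ(n) = 2s · current(n - 1).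
          (2 * s * current (α t) (n + 1 - 1) - 2 * s * current (α t) (n - 1))) t := by
      refine HasDerivAt.fun_sum fun n _ => ?_
      have hp := hα.density_pos h0 n t
      refine ((hα.hasDerivAt_density n t).log hp.ne').congr_deriv ?_
      rw [mul_div_cancel_left₀ _ hp.ne', add_sub_cancel_right]
      ring
    refine h1.neg.congr_deriv ?_
    rw [sum_Icc_neg_telescope (fun n => 2 * s * current (α t) (n - 1)), add_sub_cancel_right]
    ring
  · exact ((summable_log_density s (α t)).hasSum.comp Finset.tendsto_Icc_neg).neg
  · obtain ⟨B, hB⟩ := (isCompact_Icc (a := -T) (b := T)).exists_bound_of_continuousOn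
      hα.continuous.continuousOn
    refine ⟨2 * |s| * B, fun K t ht => ?_⟩
    have hBt := hB t (abs_le.mp ht)
    have hcur : ∀ n, |current (α t) n| ≤ B * ‖α t n‖ := fun n => by
      refine (Complex.abs_im_le_norm _).trans ?_
      rw [norm_mul, RCLike.norm_conj, mul_comm]
      exact mul_le_mul_of_nonneg_right ((norm_apply_le _ _).trans hBt) (norm_nonneg _)
    have hB0 : 0 ≤ B := (norm_nonneg _).trans hBt
    rw [norm_neg, Real.norm_eq_abs, abs_mul, abs_mul, abs_two, mul_assoc _ B]
    refine mul_le_mul_of_nonneg_left ?_ (by positivity)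
    have h1 := abs_sub (current (α t) K) (current (α t) (-K - 1))
    have h2 := hcur K
    have h3 := hcur (-K - 1)
    have h4 : 0 ≤ B * (‖α t (K + 1)‖ + ‖α t (-K)‖) := by positivity
    linarith

end Flow

/-! ### The mass and the `ℓ²` norm -/

theorem density_pos_of_norm {s : ℝ} (hs : s = 1 ∨ s = -1) {a : EllTwo} (ha : ‖a‖ ^ 2 < 1) (n : ℤ) :
    0 < density s a n := by
  have h1 : ‖a n‖ ^ 2 ≤ ‖a‖ ^ 2 := pow_le_pow_left₀ (norm_nonneg _) (norm_apply_le a n) 2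
  rw [density_eq]
  rcases hs with rfl | rfl <;> nlinarith [sq_nonneg ‖a n‖]

theorem abs_neg_log_one_sub_sub_le {x : ℝ} (hx : |x| ≤ 1 / 2) :
    |-Real.log (1 - x) - x| ≤ 2 * x ^ 2 := by
  have h := Real.abs_log_sub_add_sum_range_le (hx.trans_lt (by norm_num)) 1
  simp only [Finset.sum_range_one, zero_add, pow_one, Nat.cast_zero, div_one] at h
  rw [show -Real.log (1 - x) - x = -(x + Real.log (1 - x)) by ring, abs_neg]
  refine h.trans ?_
  rw [sq_abs, div_le_iff₀ (by linarith)]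
  nlinarith [sq_nonneg x]

theorem hasSum_mass (s : ℝ) (a : EllTwo) :
    HasSum (fun n => -Real.log (density s a n)) (mass s a) :=
  (summable_log_density s a).hasSum.neg

theorem abs_mass_sub_le {s : ℝ} (hs : s = 1 ∨ s = -1) {a : EllTwo} (ha : ‖a‖ ^ 2 ≤ 1 / 2) :
    |mass s a - s * ‖a‖ ^ 2| ≤ 2 * ‖a‖ ^ 4 := by
  have h1 := (hasSum_mass s a).sub ((hasSum_norm_sq a).mul_left s)
  have h2 := ((hasSum_norm_sq a).mul_left (2 * ‖a‖ ^ 2))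
  rw [← Real.norm_eq_abs, ← h1.tsum_eq, show 2 * ‖a‖ ^ 4 = 2 * ‖a‖ ^ 2 * ‖a‖ ^ 2 by ring]
  refine tsum_of_norm_bounded h2 fun n => ?_
  have hn : ‖a n‖ ^ 2 ≤ ‖a‖ ^ 2 := pow_le_pow_left₀ (norm_nonneg _) (norm_apply_le a n) 2
  have habs : |s * ‖a n‖ ^ 2| = ‖a n‖ ^ 2 := by
    rcases hs with rfl | rfl <;> simp
  rw [density_eq, Real.norm_eq_abs]
  refine (abs_neg_log_one_sub_sub_le (by rw [habs]; linarith)).trans ?_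
  rw [← sq_abs, habs]
  nlinarith [sq_nonneg ‖a n‖]

/-- The `ℓ²` norm of small solutions is controlled by its initial value. -/
theorem IsSolution.norm_sq_le {s : ℝ} {α : ℝ → EllTwo} (hα : IsSolution s α)
    (hs : s = 1 ∨ s = -1) (h0 : ‖α 0‖ ^ 2 ≤ 1 / 25) (t : ℝ) : ‖α t‖ ^ 2 ≤ 2 * ‖α 0‖ ^ 2 := by
  have hpos0 : ∀ n, 0 < density s (α 0) n := density_pos_of_norm hs (by linarith)
  have hpos := fun n => hα.density_pos hpos0 n t
  have hcons := hα.mass_conserved hpos0 t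
  have hM := abs_le.mp (abs_mass_sub_le hs (a := α 0) (by linarith))
  have h4 : ‖α 0‖ ^ 4 ≤ 1 / 25 * ‖α 0‖ ^ 2 := by nlinarith [sq_nonneg ‖α 0‖]
  have hsum := hasSum_mass s (α t)
  rw [hcons] at hsum
  rcases hs with rfl | rfl
  · have h1 : ‖α t‖ ^ 2 ≤ mass 1 (α 0) := hasSum_le (fun n => by
      have := Real.log_le_sub_one_of_pos (hpos n)
      have e := density_eq 1 (α t) n
      linarith) (hasSum_norm_sq (α t)) hsum
    linarith [sq_nonneg ‖α 0‖]
  · have hsum' : HasSum (fun n => Real.log (density (-1) (α t) n)) (-mass (-1) (α 0)) := by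
      simpa using hsum.neg
    have hd : ∀ n, density (-1) (α t) n = 1 + ‖α t n‖ ^ 2 := fun n => by rw [density_eq]; ring
    have hnn : ∀ n, 0 ≤ Real.log (density (-1) (α t) n) := fun n =>
      Real.log_nonneg (by rw [hd]; linarith [sq_nonneg ‖α t n‖])
    have hm : -mass (-1) (α 0) ≤ 1 / 20 := by linarith
    -- In the focusing case the conserved sum has nonnegative terms and is at most 1/20, so each
    -- site is small. Then log x ≥ 1 - 1/x gives log(1 + |α_n|²) ≥ (19/20)|α_n|², which recovers the
    -- ℓ² norm.
    have hle : ∀ n, density (-1) (α t) n ≤ 20 / 19 := fun n => by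
      have h1 := (le_hasSum hsum' n fun m _ => hnn m).trans hm
      have h2 := Real.one_sub_inv_le_log_of_pos (hpos n)
      have h3 : 19 / 20 ≤ (density (-1) (α t) n)⁻¹ := by linarith
      rw [le_inv_comm₀ (by norm_num) (hpos n)] at h3
      linarith
    have h1 : 19 / 20 * ‖α t‖ ^ 2 ≤ -mass (-1) (α 0) :=
      hasSum_le (fun n => by
        refine le_trans ?_ (Real.one_sub_inv_le_log_of_pos (hpos n))
        have h2 : 19 / 20 ≤ (density (-1) (α t) n)⁻¹ := by
          rw [le_inv_comm₀ (by norm_num) (hpos n)]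
          linarith [hle n]
        have h3 : (density (-1) (α t) n) * (density (-1) (α t) n)⁻¹ = 1 :=
          mul_inv_cancel₀ (hpos n).ne'
        have e := hd n
        nlinarith [sq_nonneg ‖α t n‖]) ((hasSum_norm_sq (α t)).mul_left (19 / 20)) hsum'
    linarith [sq_nonneg ‖α 0‖]

theorem massConverges_of_density_pos {s : ℝ} {a : EllTwo} (h : ∀ n, 0 < density s a n) :
    MassConverges s a :=
  ⟨h, summable_log_density s a⟩

/-! ### The norm of the initial data -/

theorem Lp_two_norm_sq_eq {X : Type*} [MeasurableSpace X] {μ : Measure X} (f : Lp ℂ 2 μ) :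
    ‖f‖ ^ 2 = ∫ x, ‖f x‖ ^ 2 ∂μ := by
  have h := congrArg Complex.re (L2.inner_def (𝕜 := ℂ) f f)
  have h1 : (inner ℂ f f).re = ‖f‖ ^ 2 := (norm_sq_eq_re_inner (𝕜 := ℂ) f).symm
  have h2 : ∀ x, inner ℂ (f x) (f x) = ((‖f x‖ ^ 2 : ℝ) : ℂ) := fun x => by
    rw [inner_self_eq_norm_sq_to_K]
    norm_cast
  rw [← h1, h]
  simp only [h2]
  rw [integral_complex_ofReal, Complex.ofReal_re]

/-- Sampling at the points of `h ℤ` of a function whose frequencies are bounded by `1 / h`. -/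
theorem exists_hasSum_freqProj {h N : ℝ} (hh : 0 < h) (hN : N ≤ h⁻¹) (f : LTwo) :
    ∃ S ≤ h * ‖f‖ ^ 2, HasSum (fun n : ℤ => ‖(h : ℂ) * freqProj N f (h * n)‖ ^ 2) S := by
  have hh' : 0 < h⁻¹ := inv_pos.mpr hh
  have hab : -(h⁻¹ / 2) < h⁻¹ / 2 := by linarith
  have hba : h⁻¹ / 2 - -(h⁻¹ / 2) = h⁻¹ := by ring
  set F : LTwo := 𝓕 f with hF
  have hFn : ‖F‖ = ‖f‖ := Lp.norm_fourier_eq f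
  set E : Set ℝ := {η : ℝ | |2 * Real.pi * η| ≤ N} with hE
  have hEm : MeasurableSet E :=
    measurableSet_le (by fun_prop) measurable_const
  -- The band |η| ≤ 1/(2πh) fits in one period of length 1/h because 2π > 2. The samples are
  -- therefore Fourier coefficients on that period, and Parseval applies without aliasing.
  have hsub : E ⊆ Set.Ioc (-(h⁻¹ / 2)) (h⁻¹ / 2) := fun η hη => by
    have h1 : |η| ≤ h⁻¹ / (2 * Real.pi) := by
      rw [le_div_iff₀ (by positivity)]
      have h2 : |2 * Real.pi * η| ≤ N := hη
      rw [abs_mul, abs_of_pos Real.two_pi_pos] at h2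
      linarith
    have h3 : h⁻¹ / (2 * Real.pi) < h⁻¹ / 2 := by
      apply div_lt_div_of_pos_left hh' two_pos
      linarith [Real.pi_gt_three]
    have h4 := abs_lt.mp (h1.trans_lt h3)
    exact ⟨h4.1, h4.2.le⟩
  set g : ℝ → ℂ := E.indicator F with hg
  have hgL : MemLp g 2 (volume.restrict (Set.Ioc (-(h⁻¹ / 2)) (h⁻¹ / 2))) :=
    ((Lp.memLp F).indicator hEm).restrict _
  have hsum := hasSum_sq_fourierCoeffOn hab hgL
  -- Fourier coefficients carry e^{-in·} and Fourier inversion e^{+in·}, hence the index -n.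
  have hcoef : ∀ n : ℤ, fourierCoeffOn hab g (-n) = (h : ℂ) * freqProj N f (h * n) := fun n => by
    rw [fourierCoeffOn_eq_integral, intervalIntegral.integral_of_le hab.le]
    have e : (fun x : ℝ => fourier (- -n) (x : AddCircle (h⁻¹ / 2 - -(h⁻¹ / 2))) • g x) =
        E.indicator fun η => F η *
          Complex.exp (Complex.I * ((2 * Real.pi * (h * n) * η : ℝ) : ℂ)) := by
      funext x
      by_cases hx : x ∈ E
      · rw [hg, Set.indicator_of_mem hx, Set.indicator_of_mem hx, neg_neg, fourier_coe_apply,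
          smul_eq_mul, mul_comm]
        congr 2
        rw [hba]
        push_cast
        have : (h : ℂ) ≠ 0 := by exact_mod_cast hh.ne'
        field_simp
      · rw [hg, Set.indicator_of_notMem hx, Set.indicator_of_notMem hx, smul_zero]
    rw [e, setIntegral_indicator hEm, Set.inter_eq_self_of_subset_right hsub, hba, one_div, inv_inv,
      Complex.real_smul]
    rfl
  have hsum' := (Equiv.neg ℤ).hasSum_iff.mpr hsum
  refine ⟨_, ?_, hasSum_of_eq hsum' fun n => ?_⟩
  · rw [hba, inv_inv, smul_eq_mul, intervalIntegral.integral_of_le hab.le, ← hFn,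
      Lp_two_norm_sq_eq]
    refine mul_le_mul_of_nonneg_left ?_ hh.le
    have hint : Integrable (fun x => ‖F x‖ ^ 2) :=
      (memLp_two_iff_integrable_sq_norm (Lp.aestronglyMeasurable F)).mp (Lp.memLp F)
    refine (setIntegral_mono ?_ hint.integrableOn fun x => ?_).trans
      (setIntegral_le_integral hint (.of_forall fun x => by positivity))
    · exact (memLp_two_iff_integrable_sq_norm hgL.1).mp hgL
    · refine pow_le_pow_left₀ (norm_nonneg _) ?_ 2
      exact norm_indicator_le_norm_self F x
  · rw [← hcoef]
    rfl

theorem norm_sq_initialData_le {γ h : ℝ} (hγ : γ ≤ 13 / 18) (hh : 0 < h) (hh1 : h ≤ 1)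
    (ψ₀ φ₀ : LTwo) {a : EllTwo} (ha : ∀ n, a n = initialData γ h ψ₀ φ₀ n) :
    ‖a‖ ^ 2 ≤ 2 * (h * (‖ψ₀‖ ^ 2 + ‖φ₀‖ ^ 2)) := by
  have hN : h ^ (-γ) ≤ h⁻¹ := by
    rw [← Real.rpow_neg_one]
    exact Real.rpow_le_rpow_of_exponent_ge hh hh1 (by linarith)
  obtain ⟨S, hS, h1⟩ := exists_hasSum_freqProj hh hN ψ₀
  obtain ⟨T, hT, h2⟩ := exists_hasSum_freqProj hh hN φ₀
  have h3 := hasSum_le (fun n => ?_) (hasSum_norm_sq a) ((h1.add h2).mul_left 2)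
  · linarith
  · rw [ha, initialData]
    have hsq : ‖((-1) ^ n : ℂ)‖ = 1 := by rw [norm_zpow, norm_neg, norm_one, one_zpow]
    generalize (h : ℂ) * freqProj (h ^ (-γ)) ψ₀ (h * n) = x
    generalize (h : ℂ) * freqProj (h ^ (-γ)) φ₀ (h * n) = y
    have h4 := norm_add_le x ((-1) ^ n * y)
    rw [norm_mul, hsq, one_mul] at h4
    nlinarith [norm_nonneg (x + (-1) ^ n * y), sq_nonneg (‖x‖ - ‖y‖), norm_nonneg x, norm_nonneg y]

/-! ### The quadratic part -/

/-- The circle `ℝ / 2πℤ`. -/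
abbrev Circ : Type := AddCircle (2 * Real.pi)

theorem hasSum_comp_neg {E : Type*} [AddCommMonoid E] [TopologicalSpace E] {f : ℤ → E} {x : E}
    (hf : HasSum f x) : HasSum (fun n => f (-n)) x :=
  (Equiv.neg ℤ).hasSum_iff (f := f).mpr hf

section Fourier

variable (a : EllTwo)

/-- The transform uses e^{-inθ}, so its coordinates in the standard Fourier basis are the reflected
sequence. -/
theorem latticeFourier_eq : ∃ g : EllTwo, (∀ n, g n = a (-n)) ∧ ‖g‖ = ‖a‖ ∧
    latticeFourier a = (fourierBasis (T := 2 * Real.pi)).repr.symm g := by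
  let g : EllTwo := ⟨fun n => a (-n), memlp_of_summable (hasSum_comp_neg (hasSum_norm_sq a)).summable⟩
  have hg : ‖g‖ ^ 2 = ‖a‖ ^ 2 := (hasSum_norm_sq g).unique (hasSum_comp_neg (hasSum_norm_sq a))
  refine ⟨g, fun n => rfl, (sq_eq_sq₀ (norm_nonneg _) (norm_nonneg _)).mp hg, ?_⟩
  have h := hasSum_comp_neg ((fourierBasis (T := 2 * Real.pi)).hasSum_repr_symm g)
  refine HasSum.tsum_eq (hasSum_of_eq h fun n => ?_)
  rw [coe_fourierBasis]
  change _ = a (- -n) • _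
  rw [neg_neg]

theorem fourierCoeff_latticeFourier (n : ℤ) : fourierCoeff (latticeFourier a) n = a (-n) := by
  obtain ⟨g, hg, -, h⟩ := latticeFourier_eq a
  rw [← fourierBasis_repr, h, LinearIsometryEquiv.apply_symm_apply, hg]

theorem norm_latticeFourier : ‖latticeFourier a‖ = ‖a‖ := by
  obtain ⟨g, -, hg, h⟩ := latticeFourier_eq a
  rw [h, LinearIsometryEquiv.norm_map, hg]

theorem integrable_latticeFourier_sq :
    Integrable (fun x => ‖latticeFourier a x‖ ^ 2) (AddCircle.haarAddCircle (T := 2 * Real.pi)) :=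
  (memLp_two_iff_integrable_sq_norm (Lp.aestronglyMeasurable _)).mp (Lp.memLp (latticeFourier a))

theorem integral_latticeFourier_sq :
    ∫ x, ‖latticeFourier a x‖ ^ 2 ∂(AddCircle.haarAddCircle (T := 2 * Real.pi)) = ‖a‖ ^ 2 := by
  rw [← Lp_two_norm_sq_eq, norm_latticeFourier]

theorem fourierCoeff_fourier_mul {T : ℝ} [Fact (0 < T)] (f : AddCircle T → ℂ) (d i : ℤ) :
    fourierCoeff (fun x => fourier d x * f x) i = fourierCoeff f (i - d) := by
  unfold fourierCoeff
  congr 1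
  funext x
  rw [smul_eq_mul, smul_eq_mul, ← mul_assoc, ← fourier_add]
  congr 3
  ring

/-- The autocorrelation of a sequence is the Fourier coefficient of the spectral density. -/
theorem hasSum_correlation (d : ℤ) : HasSum (fun n => a n * conj (a (n - d)))
    (∫ x, fourier d x * ((‖latticeFourier a x‖ ^ 2 : ℝ) : ℂ)
      ∂(AddCircle.haarAddCircle (T := 2 * Real.pi))) := by
  set f := latticeFourier a with hf
  have hmem : MemLp (fun x : Circ => fourier d x * f x) 2 AddCircle.haarAddCircle := by
    refine (Lp.memLp f).of_le ?_ (.of_forall fun x => ?_)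
    · exact (ContinuousMap.continuous _).aestronglyMeasurable.mul (Lp.aestronglyMeasurable f)
    · rw [norm_mul]
      have h1 : ‖(fourier d x : ℂ)‖ ≤ 1 := by
        rw [fourier_apply]
        exact (Circle.norm_coe _).le
      nlinarith [norm_nonneg (f x)]
  -- Parseval for f and e^{idθ} f: the modulation shifts the Fourier coefficients by d.
  have hP := (fourierBasis (T := 2 * Real.pi)).hasSum_inner_mul_inner f hmem.toLp
  have h1 : inner ℂ f hmem.toLp = ∫ x, fourier d x * ((‖f x‖ ^ 2 : ℝ) : ℂ)
      ∂(AddCircle.haarAddCircle (T := 2 * Real.pi)) := by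
    rw [L2.inner_def]
    refine integral_congr_ae ?_
    filter_upwards [hmem.coeFn_toLp] with x hx
    rw [hx, RCLike.inner_apply', mul_left_comm, ← Complex.normSq_eq_conj_mul_self,
      Complex.normSq_eq_norm_sq]
  rw [h1] at hP
  have hP' := hasSum_comp_subLeft hP d
  refine hasSum_of_eq hP' fun n => ?_
  rw [← inner_conj_symm, ← HilbertBasis.repr_apply_apply, ← HilbertBasis.repr_apply_apply,
    fourierBasis_repr, fourierBasis_repr, fourierCoeff_congr_ae hmem.coeFn_toLp,
    fourierCoeff_fourier_mul, fourierCoeff_latticeFourier, fourierCoeff_latticeFourier,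
    show -(d - n - d) = n by ring, show -(d - n) = n - d by ring, mul_comm]

end Fourier

theorem fourier_natCast (x : Circ) (k : ℕ) : (fourier (k : ℤ) x : ℂ) = (fourier 1 x) ^ k := by
  induction k with
  | zero => simp
  | succ k ih => rw [Nat.cast_add, Nat.cast_one, fourier_add, ih, pow_succ]

theorem norm_fourier_apply (d : ℤ) (x : Circ) : ‖(fourier d x : ℂ)‖ = 1 := by
  rw [fourier_apply]
  exact Circle.norm_coe _

/-- The symbol `ω e^{iθ} / (1 - ω e^{iθ})`. -/
def geomSymbol (ω : ℂ) (x : Circ) : ℂ := ω * fourier 1 x / (1 - ω * fourier 1 x)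

section Symbol

variable {ω : ℂ}

theorem integrable_geomSymbol_mul (hω : ‖ω‖ < 1) (a : EllTwo) :
    Integrable (fun x => geomSymbol ω x * ((‖latticeFourier a x‖ ^ 2 : ℝ) : ℂ))
      (AddCircle.haarAddCircle (T := 2 * Real.pi)) := by
  have hne : ∀ x : Circ, 1 - ω * fourier 1 x ≠ 0 := fun x h => by
    have h1 : ‖ω * fourier 1 x‖ = 1 := by rw [← sub_eq_zero.mp h, norm_one]
    rw [norm_mul, norm_fourier_apply, mul_one] at h1
    linarith
  have hc : Continuous (geomSymbol ω) := by
    have h1 : Continuous fun x : Circ => ω * fourier 1 x :=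
      continuous_const.mul (ContinuousMap.continuous _)
    exact h1.div (continuous_const.sub h1) hne
  obtain ⟨C, hC⟩ := isCompact_univ.exists_bound_of_continuousOn hc.continuousOn
  exact (integrable_latticeFourier_sq a).ofReal.bdd_mul (c := C) hc.aestronglyMeasurable
    (.of_forall fun x => hC x (Set.mem_univ x))

/-- The symbol is the geometric series ∑ ω^{k+1} e^{i(k+1)θ}. Since |ω| < 1, it may be integrated
term by term against the spectral density, each harmonic giving an autocorrelation. -/
theorem hasSum_correlation_geometric (hω : ‖ω‖ < 1) (a : EllTwo) :
    HasSum (fun k : ℕ => ω ^ (k + 1) * ∑' n, a n * conj (a (n - (k + 1))))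
      (∫ x, geomSymbol ω x * ((‖latticeFourier a x‖ ^ 2 : ℝ) : ℂ)
        ∂(AddCircle.haarAddCircle (T := 2 * Real.pi))) := by
  have hint : ∀ d : ℤ, Integrable (fun x => fourier d x * ((‖latticeFourier a x‖ ^ 2 : ℝ) : ℂ))
      (AddCircle.haarAddCircle (T := 2 * Real.pi)) := fun d =>
    (integrable_latticeFourier_sq a).ofReal.bdd_mul (c := 1)
      (ContinuousMap.continuous _).aestronglyMeasurable
      (.of_forall fun x => (norm_fourier_apply d x).le)
  have hnorm : ∀ k : ℕ, ∫ x, ‖ω ^ (k + 1) * (fourier ((k : ℤ) + 1) x *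
      ((‖latticeFourier a x‖ ^ 2 : ℝ) : ℂ))‖ ∂(AddCircle.haarAddCircle (T := 2 * Real.pi)) =
      ‖ω‖ ^ (k + 1) * ‖a‖ ^ 2 := fun k => by
    rw [← integral_latticeFourier_sq, ← integral_const_mul]
    congr 1
    funext x
    rw [norm_mul, norm_mul, norm_pow, norm_fourier_apply, one_mul, Complex.norm_real, norm_pow,
      norm_norm]
  have h := hasSum_integral_of_summable_integral_norm
    (F := fun (k : ℕ) x => ω ^ (k + 1) * (fourier ((k : ℤ) + 1) x *
      ((‖latticeFourier a x‖ ^ 2 : ℝ) : ℂ))) (μ := AddCircle.haarAddCircle (T := 2 * Real.pi))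
    (fun k => (hint (k + 1)).const_mul _) (by
      simp only [hnorm]
      exact (((summable_geometric_of_lt_one (norm_nonneg ω) hω).mul_left ‖ω‖).mul_right
        (‖a‖ ^ 2)).congr fun k => by ring)
  have e : ∀ x : Circ, ∑' k : ℕ, ω ^ (k + 1) * (fourier ((k : ℤ) + 1) x *
      ((‖latticeFourier a x‖ ^ 2 : ℝ) : ℂ)) =
      geomSymbol ω x * ((‖latticeFourier a x‖ ^ 2 : ℝ) : ℂ) := fun x => by
    have hlt : ‖ω * fourier 1 x‖ < 1 := by rwa [norm_mul, norm_fourier_apply, mul_one]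
    have hg := ((hasSum_geometric_of_norm_lt_one hlt).mul_left (ω * fourier 1 x)).mul_right
      ((‖latticeFourier a x‖ ^ 2 : ℝ) : ℂ)
    rw [geomSymbol, div_eq_mul_inv]
    refine HasSum.tsum_eq (hasSum_of_eq hg fun k => ?_)
    rw [show (k : ℤ) + 1 = ((k + 1 : ℕ) : ℤ) by push_cast; rfl, fourier_natCast]
    ring
  simp only [e] at h
  refine hasSum_of_eq h fun k => ?_
  rw [integral_const_mul, (hasSum_correlation a _).tsum_eq]

end Symbol

theorem summable_prod_of_hasSum {ι κ : Type*} {F : ι → κ → ℝ} {S : ι → ℝ} (hF : ∀ i k, 0 ≤ F i k)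
    (h : ∀ i, HasSum (F i) (S i)) (hS : Summable S) : Summable fun p : ι × κ => F p.1 p.2 := by
  rw [summable_prod_of_nonneg (fun p => hF p.1 p.2)]
  exact ⟨fun i => (h i).summable, hS.congr fun i => (h i).tsum_eq.symm⟩

/-- The leading term of the series for `A(z; α)`. -/
theorem trace_opU {z : ℂ} (hz : 1 < ‖z‖) (s : ℝ) (a : EllTwo) :
    trace (opU z a (beta s a)) =
      s * ∫ x, geomSymbol (z⁻¹ ^ 2) x * ((‖latticeFourier a x‖ ^ 2 : ℝ) : ℂ)
        ∂(AddCircle.haarAddCircle (T := 2 * Real.pi)) := by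
  have hw := norm_inv_lt_one hz
  have hω : ‖z⁻¹ ^ 2‖ < 1 := by
    rw [norm_pow]
    exact pow_lt_one₀ (norm_nonneg _) hw two_ne_zero
  have h1 : ∀ n, HasSum (fun k : ℕ => (s : ℂ) * ((z⁻¹ ^ 2) ^ (k + 1) *
      (a n * conj (a (n - (k + 1)))))) (entry (opU z a (beta s a)) n n) := fun n => by
    have h := hasSum_entry_mul (mulOp a * resP z) (mulOp (beta s a) * resM z) n n
    have hinj : Function.Injective fun k : ℕ => n - ((k : ℤ) + 1) := fun i j h => by
      simp only at h
      omega
    -- Only m = n - (k+1) contributes, by one-sidedness of `kerP`; the kernels there multiply to z⁻ᵏ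
    -- · z^{-(k+2)} = (z⁻²)^{k+1}.
    rw [← hinj.hasSum_iff] at h
    · refine hasSum_of_eq h fun k => ?_
      simp only [Function.comp, entry_mulOp_mul, entry_resP hz, entry_resM hz, beta_apply]
      rw [kerP, kerM, if_pos (by omega), if_pos (by omega),
        show (n - (n - ((k : ℤ) + 1)) - 1).toNat = k by omega,
        show (1 - (n - ((k : ℤ) + 1) - n)).toNat = k + 2 by omega]
      ring
    · intro m hm
      have : ¬ 0 < n - m := fun h0 => hm ⟨(n - m - 1).toNat, by simp only; omega⟩
      rw [entry_mulOp_mul, entry_resP hz, kerP, if_neg this]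
      simp
  have hcorr : ∀ d : ℤ, HasSum (fun n => (‖a n‖ ^ 2 + ‖a (n - d)‖ ^ 2) / 2) (‖a‖ ^ 2) := fun d => by
    have h := ((hasSum_norm_sq a).add (hasSum_comp_subRight (hasSum_norm_sq a) d)).div_const 2
    rwa [add_self_div_two] at h
  have hsum : Summable fun p : ℕ × ℤ => (s : ℂ) * ((z⁻¹ ^ 2) ^ (p.1 + 1) *
      (a p.2 * conj (a (p.2 - (p.1 + 1))))) := by
    -- |xy| ≤ (|x|² + |y|²)/2 provides a summable majorant on pairs (k, n), which justifies
    -- exchanging the two sums.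
    have hdom := summable_prod_of_hasSum
      (F := fun (k : ℕ) (n : ℤ) => ‖z⁻¹ ^ 2‖ ^ (k + 1) *
        ((‖a n‖ ^ 2 + ‖a (n - ((k : ℤ) + 1))‖ ^ 2) / 2))
      (S := fun k => ‖z⁻¹ ^ 2‖ ^ (k + 1) * ‖a‖ ^ 2)
      (fun k n => by positivity) (fun k => (hcorr ((k : ℤ) + 1)).mul_left _)
      ((((summable_geometric_of_lt_one (norm_nonneg _) hω).mul_left ‖z⁻¹ ^ 2‖).mul_right
        (‖a‖ ^ 2)).congr fun k => by ring)
    refine Summable.mul_left _ (Summable.of_norm_bounded hdom fun p => ?_)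
    rw [norm_mul, norm_mul, norm_pow, RCLike.norm_conj]
    refine mul_le_mul_of_nonneg_left ?_ (by positivity)
    nlinarith [sq_nonneg (‖a p.2‖ - ‖a (p.2 - (p.1 + 1))‖)]
  calc trace (opU z a (beta s a)) = ∑' (n : ℤ) (k : ℕ), (s : ℂ) * ((z⁻¹ ^ 2) ^ (k + 1) *
      (a n * conj (a (n - (k + 1))))) := tsum_congr fun n => (h1 n).tsum_eq.symm
    _ = ∑' (k : ℕ) (n : ℤ), (s : ℂ) * ((z⁻¹ ^ 2) ^ (k + 1) *
      (a n * conj (a (n - (k + 1))))) := Summable.tsum_comm hsum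
    _ = ∑' k : ℕ, (s : ℂ) * ((z⁻¹ ^ 2) ^ (k + 1) * ∑' n, a n * conj (a (n - (k + 1)))) :=
      tsum_congr fun k => by rw [tsum_mul_left, tsum_mul_left]
    _ = _ := ((hasSum_correlation_geometric hω a).mul_left _).tsum_eq

/-- The Poisson kernel identity behind the formula for the quadratic part. -/
theorem poisson_identity {y : ℝ} (hy : 0 < y) (θ : ℝ) :
    1 - Real.tanh (2 * y) * (1 + (geomSymbol ((Real.exp y : ℂ)⁻¹ ^ 2) (θ : Circ) +
      geomSymbol ((Complex.I * (Real.exp y : ℂ))⁻¹ ^ 2) (θ : Circ)).re) =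
      Real.sin θ ^ 2 / (Real.sinh (2 * y) ^ 2 + Real.sin θ ^ 2) := by
  have he : (fourier 1 (θ : Circ) : ℂ) = Complex.exp (θ * Complex.I) := by
    rw [fourier_coe_apply]
    congr 1
    have : (Real.pi : ℂ) ≠ 0 := by exact_mod_cast Real.pi_ne_zero
    push_cast
    field_simp
  set u : ℝ := Real.exp (2 * y) with hu
  have hu1 : 1 < u := Real.one_lt_exp_iff.mpr (by linarith)
  have huC : (Real.exp y : ℂ) ^ 2 = u := by
    rw [hu, two_mul, Real.exp_add]
    push_cast
    ring
  have h1 : (Real.exp y : ℂ)⁻¹ ^ 2 = (u : ℂ)⁻¹ := by rw [inv_pow, huC]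
  have h2 : (Complex.I * (Real.exp y : ℂ))⁻¹ ^ 2 = -(u : ℂ)⁻¹ := by
    rw [inv_pow, mul_pow, huC, Complex.I_sq, neg_one_mul, inv_neg]
  set e : ℂ := Complex.exp (θ * Complex.I) with hee
  have hre : e.re = Real.cos θ := Complex.exp_ofReal_mul_I_re θ
  have him : e.im = Real.sin θ := Complex.exp_ofReal_mul_I_im θ
  have hne : ∀ σ : ℂ, ‖σ‖ = 1 → (u : ℂ) - σ * e ≠ 0 := fun σ hσ h => by
    have h3 := congrArg norm (sub_eq_zero.mp h)
    rw [norm_mul, hσ, one_mul, hee, Complex.norm_exp_ofReal_mul_I, Complex.norm_real,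
      Real.norm_eq_abs, abs_of_pos (by linarith)] at h3
    linarith
  have hm := hne 1 norm_one
  have hp := hne (-1) (by simp)
  have hu0 : (u : ℂ) ≠ 0 := by
    have : u ≠ 0 := by positivity
    exact_mod_cast this
  have hd : (u : ℂ) ^ 2 - e ^ 2 ≠ 0 := by
    rw [show (u : ℂ) ^ 2 - e ^ 2 = (u - 1 * e) * (u - -1 * e) by ring]
    exact mul_ne_zero hm hp
  -- The two points z have z⁻² = ±1/u, so the odd harmonics cancel. What remains is 1 + 2 ∑
  -- (e/u)^{2j} over j ≥ 1, whose real part is a Poisson kernel in 2θ.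
  have hsum : 1 + (geomSymbol ((Real.exp y : ℂ)⁻¹ ^ 2) (θ : Circ) +
      geomSymbol ((Complex.I * (Real.exp y : ℂ))⁻¹ ^ 2) (θ : Circ)) =
      ((u : ℂ) ^ 2 + e ^ 2) / ((u : ℂ) ^ 2 - e ^ 2) := by
    rw [geomSymbol, geomSymbol, h1, h2, he]
    have a1 : (1 : ℂ) - (u : ℂ)⁻¹ * e = (u - 1 * e) / u := by field_simp
    have a2 : (1 : ℂ) - -(u : ℂ)⁻¹ * e = (u - -1 * e) / u := by field_simp
    rw [a1, a2]
    rw [one_mul] at *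
    rw [neg_one_mul, sub_neg_eq_add] at *
    field_simp
    ring
  have hRe : 1 + (geomSymbol ((Real.exp y : ℂ)⁻¹ ^ 2) (θ : Circ) +
      geomSymbol ((Complex.I * (Real.exp y : ℂ))⁻¹ ^ 2) (θ : Circ)).re =
      (u ^ 4 - 1) / ((u ^ 2 - 1) ^ 2 + 4 * u ^ 2 * Real.sin θ ^ 2) := by
    have hr := congrArg Complex.re hsum
    rw [Complex.add_re, Complex.one_re] at hr
    rw [hr, Complex.div_re]
    have hsc := Real.sin_sq_add_cos_sq θ
    have n1 : Complex.normSq ((u : ℂ) ^ 2 - e ^ 2) =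
        (u ^ 2 - 1) ^ 2 + 4 * u ^ 2 * Real.sin θ ^ 2 := by
      simp only [Complex.normSq_apply, pow_two, Complex.sub_re, Complex.mul_re, Complex.sub_im,
        Complex.mul_im, Complex.ofReal_re, Complex.ofReal_im, hre, him]
      have hc : Real.cos θ ^ 2 = 1 - Real.sin θ ^ 2 := by linarith
      ring_nf
      rw [show Real.cos θ ^ 4 = (Real.cos θ ^ 2) ^ 2 by ring, hc]
      ring
    rw [n1, ← add_div]
    congr 1
    simp only [pow_two, Complex.sub_re, Complex.mul_re, Complex.sub_im, Complex.add_re,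
      Complex.add_im, Complex.mul_im, Complex.ofReal_re, Complex.ofReal_im, hre, him]
    have hc : Real.cos θ ^ 2 = 1 - Real.sin θ ^ 2 := by linarith
    ring_nf
    rw [show Real.cos θ ^ 4 = (Real.cos θ ^ 2) ^ 2 by ring, hc]
    ring
  rw [hRe, Real.tanh_eq_sinh_div_cosh, Real.sinh_eq, Real.cosh_eq, Real.exp_neg, ← hu]
  have hu0' : 0 < u := by linarith
  have hD : 0 < (u ^ 2 - 1) ^ 2 + 4 * u ^ 2 * Real.sin θ ^ 2 := by
    have : 0 < (u ^ 2 - 1) ^ 2 := by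
      have : 0 < u ^ 2 - 1 := by nlinarith
      positivity
    positivity
  have hD2 : ((u - u⁻¹) / 2) ^ 2 + Real.sin θ ^ 2 =
      ((u ^ 2 - 1) ^ 2 + 4 * u ^ 2 * Real.sin θ ^ 2) / (4 * u ^ 2) := by
    field_simp
    ring
  have ht : (u - u⁻¹) / 2 / ((u + u⁻¹) / 2) = (u ^ 2 - 1) / (u ^ 2 + 1) := by
    field_simp
  rw [hD2, ht]
  generalize hDe : (u ^ 2 - 1) ^ 2 + 4 * u ^ 2 * Real.sin θ ^ 2 = D at hD
  field_simp
  rw [← hDe]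
  ring

/-! ### Comparison of G with its quadratic part. -/

theorem norm_exp_ofReal (y : ℝ) : ‖(Real.exp y : ℂ)‖ = Real.exp y := by
  rw [Complex.norm_real, Real.norm_eq_abs, Real.abs_exp]

theorem norm_I_mul_exp_ofReal (y : ℝ) : ‖Complex.I * (Real.exp y : ℂ)‖ = Real.exp y := by
  rw [norm_mul, Complex.norm_I, one_mul, norm_exp_ofReal]

theorem one_lt_norm_exp {y : ℝ} (hy : 0 < y) {z : ℂ} (hz : ‖z‖ = Real.exp y) : 1 < ‖z‖ := by
  rw [hz]
  exact Real.one_lt_exp_iff.mpr hy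

theorem resConst_eq {y : ℝ} (hy : 0 < y) {z : ℂ} (hz : ‖z‖ = Real.exp y) :
    resConst z = (2 * Real.sinh y)⁻¹ := by
  have h1 : 1 < Real.exp y := Real.one_lt_exp_iff.mpr hy
  rw [resConst, norm_inv, hz, Real.sinh_eq, Real.exp_neg]
  have h2 : Real.exp y ^ 2 - 1 ≠ 0 := by nlinarith
  field_simp

theorem funGQuad_eq {y : ℝ} (hy : 0 < y) (a : EllTwo) :
    funGQuad y a = ‖a‖ ^ 2 - Real.tanh (2 * y) * (‖a‖ ^ 2 +
      (∫ x, geomSymbol ((Real.exp y : ℂ)⁻¹ ^ 2) x * ((‖latticeFourier a x‖ ^ 2 : ℝ) : ℂ)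
          ∂(AddCircle.haarAddCircle (T := 2 * Real.pi)) +
        ∫ x, geomSymbol ((Complex.I * (Real.exp y : ℂ))⁻¹ ^ 2) x *
          ((‖latticeFourier a x‖ ^ 2 : ℝ) : ℂ)
          ∂(AddCircle.haarAddCircle (T := 2 * Real.pi))).re) := by
  have hω : ∀ z : ℂ, ‖z‖ = Real.exp y → ‖z⁻¹ ^ 2‖ < 1 := fun z hz => by
    rw [norm_pow]
    exact pow_lt_one₀ (norm_nonneg _) (norm_inv_lt_one (one_lt_norm_exp hy hz)) two_ne_zero
  have i1 := integrable_geomSymbol_mul (hω _ (norm_exp_ofReal y)) a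
  have i2 := integrable_geomSymbol_mul (hω _ (norm_I_mul_exp_ofReal y)) a
  set ω₁ := (Real.exp y : ℂ)⁻¹ ^ 2
  set ω₂ := (Complex.I * (Real.exp y : ℂ))⁻¹ ^ 2
  have i12 : Integrable (fun x => (geomSymbol ω₁ x * ((‖latticeFourier a x‖ ^ 2 : ℝ) : ℂ) +
      geomSymbol ω₂ x * ((‖latticeFourier a x‖ ^ 2 : ℝ) : ℂ)).re)
      (AddCircle.haarAddCircle (T := 2 * Real.pi)) := (i1.add i2).re
  have i0 := integrable_latticeFourier_sq a
  have i3 : Integrable (fun x => Real.tanh (2 * y) * (‖latticeFourier a x‖ ^ 2 +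
      (geomSymbol ω₁ x * ((‖latticeFourier a x‖ ^ 2 : ℝ) : ℂ) +
        geomSymbol ω₂ x * ((‖latticeFourier a x‖ ^ 2 : ℝ) : ℂ)).re))
      (AddCircle.haarAddCircle (T := 2 * Real.pi)) := (i0.add i12).const_mul _
  have hre : ∫ x, (geomSymbol ω₁ x * ((‖latticeFourier a x‖ ^ 2 : ℝ) : ℂ) +
      geomSymbol ω₂ x * ((‖latticeFourier a x‖ ^ 2 : ℝ) : ℂ)).re
        ∂(AddCircle.haarAddCircle (T := 2 * Real.pi)) =
      (∫ x, (geomSymbol ω₁ x * ((‖latticeFourier a x‖ ^ 2 : ℝ) : ℂ) +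
        geomSymbol ω₂ x * ((‖latticeFourier a x‖ ^ 2 : ℝ) : ℂ))
        ∂(AddCircle.haarAddCircle (T := 2 * Real.pi))).re := integral_re (i1.add i2)
  rw [← integral_add i1 i2, ← integral_latticeFourier_sq, ← hre,
    ← integral_add i0 i12, ← integral_const_mul, ← integral_sub i0 i3,
    AddCircle.integral_haarAddCircle,
    ← AddCircle.intervalIntegral_preimage (2 * Real.pi) (-Real.pi), smul_eq_mul,
    ← intervalIntegral.integral_const_mul, funGQuad, show -Real.pi + 2 * Real.pi = Real.pi by ring]
  refine intervalIntegral.integral_congr fun θ _ => ?_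
  rw [← add_mul, Complex.re_mul_ofReal, mul_div_right_comm, ← poisson_identity hy θ]
  ring

/-- This coefficient of M supplies exactly the 1 - tanh(2y) needed in the Poisson identity. -/
theorem two_div_exp_add_one (y : ℝ) :
    2 / (Real.exp (4 * y) + 1) = 1 - Real.tanh (2 * y) := by
  rw [Real.tanh_eq_sinh_div_cosh, Real.sinh_eq, Real.cosh_eq, Real.exp_neg,
    show 4 * y = 2 * y + 2 * y by ring, Real.exp_add]
  have := Real.exp_pos (2 * y)
  field_simp
  ring

/-- `G^{[2]}` collects the quadratic terms of `G`. -/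
theorem funGQuad_eq_quadratic {s : ℝ} (hs : s = 1 ∨ s = -1) {y : ℝ} (hy : 0 < y) (a : EllTwo) :
    funGQuad y a = s * (2 / (Real.exp (4 * y) + 1)) * (s * ‖a‖ ^ 2) - s * Real.tanh (2 * y) *
      (trace (opU (Real.exp y : ℂ) a (beta s a)) +
        trace (opU (Complex.I * (Real.exp y : ℂ)) a (beta s a))).re := by
  rw [trace_opU (one_lt_norm_exp hy (norm_exp_ofReal y)),
    trace_opU (one_lt_norm_exp hy (norm_I_mul_exp_ofReal y)), ← mul_add, Complex.re_ofReal_mul,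
    funGQuad_eq hy, two_div_exp_add_one]
  rcases hs with rfl | rfl <;> ring

/-- This factor sinh y reduces the (sinh y)⁻² coming from the square of the trace bound to the
single (sinh y)⁻¹ of the final estimate. -/
theorem tanh_two_mul_le {y : ℝ} (hy : 0 < y) : Real.tanh (2 * y) ≤ 2 * Real.sinh y := by
  have h1 := Real.sinh_pos_iff.mpr hy
  have h2 := Real.cosh_pos y
  have h3 := Real.one_le_cosh y
  rw [Real.tanh_eq_sinh_div_cosh, Real.sinh_two_mul, Real.cosh_two_mul, div_le_iff₀ (by positivity)]
  nlinarith [sq_nonneg (Real.sinh y), mul_pos h1 h2, mul_nonneg h1.le (sub_nonneg.mpr h3)]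

theorem two_div_exp_add_one_le {y : ℝ} (hy : 0 < y) :
    2 / (Real.exp (4 * y) + 1) ≤ (Real.sinh y)⁻¹ := by
  have h1 := Real.sinh_pos_iff.mpr hy
  rw [div_le_iff₀ (by positivity), ← div_eq_inv_mul, le_div_iff₀ h1, Real.sinh_eq]
  have h2 : Real.exp y ≤ Real.exp (4 * y) := Real.exp_le_exp.mpr (by linarith)
  have h3 := Real.exp_pos (-y)
  linarith

/-- The quartic remainder in `G`. -/
theorem abs_funG_sub_funGQuad_le {s : ℝ} (hs : s = 1 ∨ s = -1) {y : ℝ} (hy : 0 < y) {a : EllTwo}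
    (ha : ‖a‖ ^ 2 ≤ 1 / 2) (hq : ‖a‖ ^ 2 * (2 * Real.sinh y)⁻¹ ≤ 1 / 2) :
    |funG s y a - funGQuad y a| ≤ 4 * (Real.sinh y)⁻¹ * ‖a‖ ^ 4 := by
  have hsh := Real.sinh_pos_iff.mpr hy
  have hs1 : |s| = 1 := by rcases hs with rfl | rfl <;> simp
  have hA : ∀ z : ℂ, ‖z‖ = Real.exp y → ‖genA s z a - trace (opU z a (beta s a))‖ ≤
      2 * (‖a‖ ^ 2 * (2 * Real.sinh y)⁻¹) ^ 2 := fun z hz => by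
    have h := norm_logTrace_sub_trace_le (one_lt_norm_exp hy hz) (a := a) (b := beta s a)
      (by rwa [norm_beta hs, ← sq, resConst_eq hy hz])
    rwa [norm_beta hs, ← sq, resConst_eq hy hz] at h
  have hA1 := hA _ (norm_exp_ofReal y)
  have hA2 := hA _ (norm_I_mul_exp_ofReal y)
  have hM := abs_mass_sub_le hs ha
  have hth : 0 ≤ Real.tanh (2 * y) := by
    rw [Real.tanh_eq_sinh_div_cosh]
    exact div_nonneg (Real.sinh_nonneg_iff.mpr (by linarith)) (Real.cosh_pos _).le
  rw [funGQuad_eq_quadratic hs hy, funG]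
  set A1 := genA s (Real.exp y : ℂ) a
  set A2 := genA s (Complex.I * (Real.exp y : ℂ)) a
  set t1 := trace (opU (Real.exp y : ℂ) a (beta s a))
  set t2 := trace (opU (Complex.I * (Real.exp y : ℂ)) a (beta s a))
  have hre : |((A1 - t1) + (A2 - t2)).re| ≤ 4 * (‖a‖ ^ 2 * (2 * Real.sinh y)⁻¹) ^ 2 :=
    (Complex.abs_re_le_norm _).trans ((norm_add_le _ _).trans (by linarith))
  have e : s * (2 / (Real.exp (4 * y) + 1)) * mass s a - s * Real.tanh (2 * y) * (A1 + A2).re -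
      (s * (2 / (Real.exp (4 * y) + 1)) * (s * ‖a‖ ^ 2) - s * Real.tanh (2 * y) * (t1 + t2).re) =
      s * ((2 / (Real.exp (4 * y) + 1)) * (mass s a - s * ‖a‖ ^ 2)) -
        s * (Real.tanh (2 * y) * ((A1 - t1) + (A2 - t2)).re) := by
    simp only [Complex.add_re, Complex.sub_re]
    ring
  rw [e]
  refine (abs_sub _ _).trans ?_
  rw [abs_mul s, abs_mul s, hs1, one_mul, one_mul, abs_mul, abs_mul, abs_of_nonneg hth,
    abs_of_nonneg (by positivity : 0 ≤ 2 / (Real.exp (4 * y) + 1))]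
  have b1 : 2 / (Real.exp (4 * y) + 1) * |mass s a - s * ‖a‖ ^ 2| ≤
      (Real.sinh y)⁻¹ * (2 * ‖a‖ ^ 4) :=
    mul_le_mul (two_div_exp_add_one_le hy) hM (abs_nonneg _) (by positivity)
  have b2 : Real.tanh (2 * y) * |((A1 - t1) + (A2 - t2)).re| ≤
      2 * Real.sinh y * (4 * (‖a‖ ^ 2 * (2 * Real.sinh y)⁻¹) ^ 2) :=
    mul_le_mul (tanh_two_mul_le hy) hre (abs_nonneg _) (by positivity)
  have b3 : 2 * Real.sinh y * (4 * (‖a‖ ^ 2 * (2 * Real.sinh y)⁻¹) ^ 2) =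
      (Real.sinh y)⁻¹ * (2 * ‖a‖ ^ 4) := by
    field_simp
    ring
  linarith

theorem genAConverges {s : ℝ} (hs : s = 1 ∨ s = -1) {z : ℂ} (hz : 1 < ‖z‖) {a : EllTwo}
    (hq : ‖a‖ ^ 2 * resConst z < 1) : GenAConverges s z a := by
  refine ⟨isUnit_shift_sub (norm_inv_lt_one hz), isUnit_sub_shift hz,
    fun k => isTraceClass_opU_pow hz a (beta s a) k, ?_⟩
  refine summable_logTrace hz (b := beta s a) ?_
  rwa [norm_beta hs, ← sq]

end AblowitzLadik

end

open AblowitzLadik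
-- Choice of constants and conclusion.
theorem proposition3p3 :
    ∃ C : ℝ, 0 < C ∧ ∃ κ₀ : ℝ → ℝ → ℝ, (∀ p q : ℝ, 0 < κ₀ p q) ∧
      ∀ (s : ℝ) (_ : s = 1 ∨ s = -1)
        (γ : ℝ) (_ : 0 < γ) (_ : γ ≤ 13 / 18)
        (ψ₀ φ₀ : LTwo)
        (h : ℝ) (_ : 0 < h) (_ : h ≤ 1) (_ : 100 * h * (‖ψ₀‖ ^ 2 + ‖φ₀‖ ^ 2) ≤ 1)
        (α : ℝ → EllTwo) (_ : IsSolution s α)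
        (_ : ∀ n : ℤ, α 0 n = initialData γ h ψ₀ φ₀ n)
        (κ : ℝ) (_ : κ₀ ‖ψ₀‖ ‖φ₀‖ ≤ κ),
        (∀ t : ℝ, FunGConverges s (κ * h) (α t)) ∧
        (∀ t : ℝ, funG s (κ * h) (α t) = funG s (κ * h) (α 0)) ∧
        (∀ t : ℝ, |funG s (κ * h) (α t) - funGQuad (κ * h) (α t)| ≤
          C * (Real.sinh (κ * h))⁻¹ * ‖α 0‖ ^ 4) := by
  -- 16 = 4 · 4: the factor 4 of `abs_funG_sub_funGQuad_le` at time t, times 4 from ‖α t‖² ≤ 2‖α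
  -- 0‖². In κ₀ the summand 1 ensures positivity, and the rest makes the geometric ratio at most
  -- 1/2.
  refine ⟨16, by norm_num, fun p q => 1 + 4 * (p ^ 2 + q ^ 2), fun p q => by positivity, ?_⟩
  intro s hs γ _ hγ ψ₀ φ₀ h hh hh1 hsmall α hα hdata κ hκ
  have hκ0 : 0 < κ := lt_of_lt_of_le (by positivity) hκ
  have hy : 0 < κ * h := mul_pos hκ0 hh
  have hsh := Real.sinh_pos_iff.mpr hy
  have hini := norm_sq_initialData_le hγ hh hh1 ψ₀ φ₀ hdata
  have h0 : ‖α 0‖ ^ 2 ≤ 1 / 25 := by linarith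
  have hnorm := hα.norm_sq_le hs h0
  have hhalf : ∀ t, ‖α t‖ ^ 2 ≤ 1 / 2 := fun t => by linarith [hnorm t]
  have hq : ∀ t, ‖α t‖ ^ 2 * (2 * Real.sinh (κ * h))⁻¹ ≤ 1 / 2 := fun t => by
    rw [← div_eq_mul_inv, div_le_iff₀ (by positivity)]
    -- ‖α t‖² ≤ 2‖α 0‖² ≤ 4h(‖ψ₀‖² + ‖φ₀‖²) ≤ κh ≤ sinh(κh).
    have h1 := (Real.self_le_sinh_iff).mpr hy.le
    have h2 := mul_le_mul_of_nonneg_right hκ hh.le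
    linarith [hnorm t]
  have hqz : ∀ z : ℂ, ‖z‖ = Real.exp (κ * h) → ∀ t, ‖α t‖ ^ 2 * resConst z ≤ 1 / 2 :=
    fun z hz t => by
      rw [resConst_eq hy hz]
      exact hq t
  have hone : ∀ t, ‖α t‖ ≤ 1 := fun t => by nlinarith [hhalf t, norm_nonneg (α t)]
  have hz1 := norm_exp_ofReal (κ * h)
  have hz2 := norm_I_mul_exp_ofReal (κ * h)
  have hpos : ∀ t n, 0 < density s (α t) n := fun t =>
    density_pos_of_norm hs ((hhalf t).trans_lt (by norm_num))
  refine ⟨fun t => ⟨massConverges_of_density_pos (hpos t), ?_, ?_⟩, fun t => ?_, fun t => ?_⟩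
  · exact genAConverges hs (one_lt_norm_exp hy hz1) ((hqz _ hz1 t).trans_lt (by norm_num))
  · exact genAConverges hs (one_lt_norm_exp hy hz2) ((hqz _ hz2 t).trans_lt (by norm_num))
  · rw [funG, funG, hα.mass_conserved (hpos 0),
      genA_conserved (one_lt_norm_exp hy hz1) hs hα hone (hqz _ hz1) t,
      genA_conserved (one_lt_norm_exp hy hz2) hs hα hone (hqz _ hz2) t]
  · refine (abs_funG_sub_funGQuad_le hs hy (hhalf t) (hq t)).trans ?_
    have h4 : ‖α t‖ ^ 4 ≤ 4 * ‖α 0‖ ^ 4 := by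
      calc ‖α t‖ ^ 4 = (‖α t‖ ^ 2) ^ 2 := by ring
        _ ≤ (2 * ‖α 0‖ ^ 2) ^ 2 := pow_le_pow_left₀ (by positivity) (hnorm t) 2
        _ = _ := by ring
    calc _ ≤ 4 * (Real.sinh (κ * h))⁻¹ * (4 * ‖α 0‖ ^ 4) :=
          mul_le_mul_of_nonneg_left h4 (by positivity)
      _ = _ := by ring
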